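/- Let $k\in\mathbb R$ and, for $0<|s|<r$, put $$\overline{\varphi}(r,s)=\frac{r^{2(k^2+1)}(r^2-s^2)\,e^{2k\arctan\left(k-\frac{(1+k^2)s}{\sqrt{r^2-s^2}}\right)}}{k^2s^2-2ks\sqrt{r^2-s^2}+r^2}.$$ Let $U$ be an open set of pairs $(x,y)\in\mathbb R^n\times(\mathbb R^n\setminus\{0\})$ that is invariant under $(x,y)\mapsto(x,cy)$, $c>0$, and let $F$ be a (conic) Finsler metric on $U$: $F$ is smooth and positive on $U$, $F(x,cy)=cF(x,y)$ for $c>0$, and the matrix $g_{ij}=\tfrac12\,\partial^2F^2/\partial y^i\partial y^j$ is positive definite on $U$. (For $U=M\times(\mathbb R^n\setminus\{0\})$ this is a Finsler metric on $M$ in the classical sense.) Assume that $F$ is spherically symmetric, $$F(x,y)=|y|\,\phi\!\left(|x|,\frac{\langle x,y\rangle}{|y|}\right)\quad\text{on }U,$$ and that at all pairs $(r,s)=(|x|,\langle x,y\rangle/|y|)$, $(x,y)\in U$, with $0<|s|<r$, $$\phi(r,s)=s\,h(r)-s\int\frac{\eta(\overline{\varphi}(r,s))}{s^2\sqrt{r^2-s^2}}\,ds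 ,$$ where $h,\eta$ are arbitrary real functions, differentiable at the arguments that occur, and the integral is any primitive with respect to $s$. Then: 1. $F$ has scalar flag curvature on $U$, that is, the flag curvature of the flag with pole $y\in T_x$ and plane $\mathrm{span}\{y,u\}$ depends only on $(x,y)$. 2. If $k=0$, then $F$ is projectively flat: all its geodesics lie on straight lines. 3. If $k\ne0$, $n\ge3$ and $U\neq\emptyset$, then $F$ is not of Douglas type, that is, its Douglas curvature does not vanish identically on $U$. Moreover such metrics exist: for every $n\ge3$ and every $k\ne0$ there are $h,\eta,\phi$ such that $F=|y|\phi(|x|,\langle x,y\rangle/|y|)$ is a Finsler metric of the above form on the set of all $(x,y)$ with $x,y$ linearly independent; it has scalar flag curvature and is not of Douglas type. -/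

import Mathlib

open scoped ContDiff

noncomputable section

namespace SphFinsler

/-- The model space `ℝⁿ` with its Euclidean norm and inner product. A point of its tangent bundle is
a pair `(x, y)` with `x` the base point and `y` the tangent vector. -/
abbrev E (n : ℕ) : Type := EuclideanSpace ℝ (Fin n)

variable {n : ℕ}

/-- `∂f/∂xⁱ` for a function `f(x, y)` on the tangent bundle. -/
def dx (i : Fin n) (f : E n → E n → ℝ) (x y : E n) : ℝ :=
  fderiv ℝ (fun z => f z y) x (EuclideanSpace.single i 1)

/-- `∂f/∂yⁱ` for a function `f(x, y)` on the tangent bundle. -/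
def dy (i : Fin n) (f : E n → E n → ℝ) (x y : E n) : ℝ :=
  fderiv ℝ (fun z => f x z) y (EuclideanSpace.single i 1)

/-- `F²`. -/
def energy (F : E n → E n → ℝ) (x y : E n) : ℝ := F x y ^ 2

/-- The fundamental tensor `g_ij(x, y) = ½ ∂²F²/∂yⁱ∂yʲ`. -/
def fundTensor (F : E n → E n → ℝ) (x y : E n) : Matrix (Fin n) (Fin n) ℝ :=
  Matrix.of fun i j => (1 / 2) * dy i (dy j (energy F)) x y

/-- The inner product `g_y(u, v) = g_ij(x, y) uⁱ vʲ` on the tangent space at `x`. -/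
def fundInner (F : E n → E n → ℝ) (x y u v : E n) : ℝ :=
  ∑ i, ∑ j, fundTensor F x y i j * u i * v j

/-- `F` is a Finsler metric on the open set `U` of nonzero tangent vectors, where `U` is stable under
positive rescaling of vectors: `F` is smooth, positive and positively homogeneous of degree one
in `y`, and its fundamental tensor is positive definite. For `U = M × (ℝⁿ ∖ {0})` this is a Finsler
metric on `M` in the classical sense; in general it is a conic Finsler metric. -/
structure IsFinslerOn (F : E n → E n → ℝ) (U : Set (E n × E n)) : Prop where
  isOpen : IsOpen U
  ne_zero : ∀ x y, (x, y) ∈ U → y ≠ 0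
  smul_mem : ∀ x y, (x, y) ∈ U → ∀ c : ℝ, 0 < c → (x, c • y) ∈ U
  pos : ∀ x y, (x, y) ∈ U → 0 < F x y
  homogeneous : ∀ x y, (x, y) ∈ U → ∀ c : ℝ, 0 < c → F x (c • y) = c * F x y
  smooth : ContDiffOn ℝ ∞ (fun p : E n × E n => F p.1 p.2) U
  posDef : ∀ x y, (x, y) ∈ U → (fundTensor F x y).PosDef

/-- The geodesic coefficients
`Gⁱ = ¼ gⁱˡ (∂²F²/∂xᵏ∂yˡ yᵏ - ∂F²/∂xˡ)`. -/
def spray (F : E n → E n → ℝ) (i : Fin n) (x y : E n) : ℝ :=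
  (1 / 4) * ∑ l, (fundTensor F x y)⁻¹ i l *
    (∑ m, dx m (dy l (energy F)) x y * y m - dx l (energy F) x y)

/-- The Riemann curvature
`Rⁱ_m = 2 ∂Gⁱ/∂xᵐ - yʲ ∂²Gⁱ/∂xʲ∂yᵐ + 2 Gʲ ∂²Gⁱ/∂yʲ∂yᵐ - ∂Gⁱ/∂yʲ ∂Gʲ/∂yᵐ`. -/
def riemann (F : E n → E n → ℝ) (x y : E n) (i m : Fin n) : ℝ :=
  2 * dx m (spray F i) x y
    - ∑ j, y j * dx j (dy m (spray F i)) x y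
    + 2 * ∑ j, spray F j x y * dy j (dy m (spray F i)) x y
    - ∑ j, dy j (spray F i) x y * dy m (spray F j) x y

/-- The Riemann curvature as an endomorphism: `(R_y(u))ⁱ = Rⁱ_m uᵐ`. -/
def riemannApply (F : E n → E n → ℝ) (x y u : E n) : E n :=
  WithLp.toLp 2 fun i => ∑ m, riemann F x y i m * u m

/-- The flag curvature of the flag with pole `y` and plane spanned by `y` and `u`. -/
def flagCurvature (F : E n → E n → ℝ) (x y u : E n) : ℝ :=
  fundInner F x y (riemannApply F x y u) u /
    (fundInner F x y y y * fundInner F x y u u - fundInner F x y y u ^ 2)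

/-- Scalar flag curvature: the flag curvature depends on `(x, y)` only, not on the plane. -/
def HasScalarFlagCurvature (F : E n → E n → ℝ) (U : Set (E n × E n)) : Prop :=
  ∃ K : E n → E n → ℝ, ∀ x y, (x, y) ∈ U → ∀ u : E n,
    LinearIndependent ℝ ![y, u] → flagCurvature F x y u = K x y

/-- The Douglas curvature
`D_jⁱ_ml = ∂³/∂yʲ∂yᵐ∂yˡ (Gⁱ - (1/(n+1)) (∂Gᵖ/∂yᵖ) yⁱ)`. -/
def douglas (F : E n → E n → ℝ) (i j m l : Fin n) (x y : E n) : ℝ :=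
  dy j (dy m (dy l (fun a b =>
    spray F i a b - (1 / ((n : ℝ) + 1)) * (∑ p, dy p (spray F p) a b) * b i))) x y

/-- Metrics of Douglas type: the Douglas curvature vanishes. -/
def IsDouglasOn (F : E n → E n → ℝ) (U : Set (E n × E n)) : Prop :=
  ∀ x y, (x, y) ∈ U → ∀ i j m l : Fin n, douglas F i j m l x y = 0

/-- `γ` is a geodesic on the interval `(a, b)`: its velocity stays in `U` and it solves
`γ'' + 2 G(γ, γ') = 0`. -/
def IsGeodesicOn (F : E n → E n → ℝ) (U : Set (E n × E n)) (γ : ℝ → E n) (a b : ℝ) : Prop :=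
  ∀ t ∈ Set.Ioo a b, (γ t, deriv γ t) ∈ U ∧ DifferentiableAt ℝ γ t ∧
    HasDerivAt (deriv γ) (WithLp.toLp 2 fun i => -2 * spray F i (γ t) (deriv γ t)) t

/-- Projectively flat metrics: every geodesic runs inside a straight line. -/
def IsProjectivelyFlatOn (F : E n → E n → ℝ) (U : Set (E n × E n)) : Prop :=
  ∀ (γ : ℝ → E n) (a b : ℝ), IsGeodesicOn F U γ a b →
    ∃ p v : E n, ∀ t ∈ Set.Ioo a b, ∃ c : ℝ, γ t = p + c • v

/-- `F(x, y) = |y| φ(|x|, ⟨x, y⟩ / |y|)` on `U`. -/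
def IsSphericallySymmetricOn (φ : ℝ → ℝ → ℝ) (F : E n → E n → ℝ) (U : Set (E n × E n)) : Prop :=
  ∀ x y, (x, y) ∈ U → F x y = ‖y‖ * φ ‖x‖ (inner ℝ x y / ‖y‖)

/-- The set of pairs `(r, s) = (|x|, ⟨x, y⟩ / |y|)` that occur on `U`, without those at which
`s = 0` or `|s| = r`. -/
def profileDomain (U : Set (E n × E n)) : Set (ℝ × ℝ) :=
  {q | q.2 ≠ 0 ∧ |q.2| < q.1 ∧ ∃ x y, (x, y) ∈ U ∧ q = (‖x‖, inner ℝ x y / ‖y‖)}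

/-- The function `φ̄(r, s)` with parameter `k`. -/
def phiBar (k r s : ℝ) : ℝ :=
  r ^ (2 * (k ^ 2 + 1)) * (r ^ 2 - s ^ 2) *
      Real.exp (2 * k * Real.arctan (k - (1 + k ^ 2) * s / √(r ^ 2 - s ^ 2))) /
    (k ^ 2 * s ^ 2 - 2 * k * s * √(r ^ 2 - s ^ 2) + r ^ 2)

/-- `φ(r, s) = s h(r) - s ∫ η(φ̄(r, s)) / (s² √(r² - s²)) ds` on `Ω`. The indefinite integral is an
arbitrary primitive `I` with respect to `s`, for each `r`; the functions `h` and `η` need only be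
differentiable at the arguments that occur. -/
def HasProfileOn (k : ℝ) (h η : ℝ → ℝ) (φ : ℝ → ℝ → ℝ) (Ω : Set (ℝ × ℝ)) : Prop :=
  ∃ I : ℝ → ℝ → ℝ, ∀ r s, (r, s) ∈ Ω →
    DifferentiableAt ℝ h r ∧ DifferentiableAt ℝ η (phiBar k r s) ∧
    HasDerivAt (I r) (η (phiBar k r s) / (s ^ 2 * √(r ^ 2 - s ^ 2))) s ∧
    φ r s = s * h r - s * I r s

/-- All tangent vectors `y` at points `x` with `x` and `y` not parallel. -/
def nonRadial (n : ℕ) : Set (E n × E n) :=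
  {p | LinearIndependent ℝ ![p.1, p.2]}

end SphFinsler

end

/-! Write a = |x|², b = |y|², v = ⟨x,y⟩, A = √(ab - v²). The point is that every metric of the given
form, whatever h and η are, is projectively related to one explicit spray: its geodesic coefficients
are G = T x + P y with T = (2kvA - k²v²)/(2a²), and only the scalar P depends on h and η.

This follows from Rapcsák's equation F_{xu}-type identity D_{(y,0)}D_{(0,u)}F - D_{(u,0)}F = 2T
D_{(0,x)}D_{(0,u)}F (`rapcsak`). If u ⟂ x, the integral formula for φ gives D_{(0,u)}F = N⟨y,u⟩ with
N = η(φ̄)/A, since the h-term is v h(|x|). Rotation invariance expresses D_{(u,0)}F through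
y-derivatives, and the equation shrinks to the transport equation D_{(y,0)}N = 2T D_{(0,x)}N. Both
directions are shears that preserve A, so it suffices that φ̄ satisfies the same equation, and this
determines T. A multiple of y in u contributes nothing, by homogeneity.

Scalar curvature: for G = T x + P y the curvature R(u) is a combination of u, y and x. The
coefficient of x depends on T alone and vanishes by a direct computation (`coefT_curvature`). The
coefficient of y is then forced by g(R(u), y) = 0, so the flag curvature is a function of (x,y). If
k = 0 then T = 0, G is parallel to y and geodesics are straight. If k ≠ 0, removing the trace of the
spray removes P and leaves a y-component proportional to kA - k²v. Along y + tf with f orthogonal to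
x and y, A is the square root of a nonconstant quadratic in t, and a third derivative of the
potential survives.

All this happens where v ≠ 0 and A > 0. In dimension at least two such pairs are dense in U, so
closed conditions extend by continuity. Existence is shown by an explicit metric |x|^{2k²} A L(v/A)
with L convex and positive, taking h = 0 and η the identity. -/

open scoped ContDiff

noncomputable section

namespace SphFinsler

open Filter Topology Set

/-! ### Calculus of directional derivatives -/

section Directional

variable {V W : Type*} [NormedAddCommGroup V] [NormedSpace ℝ V]
  [NormedAddCommGroup W] [NormedSpace ℝ W]

/-- The derivative of `f` at `p` in the direction `w`. -/
def D (w : V) (f : V → W) (p : V) : W := fderiv ℝ f p w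

theorem ContDiffOn.diffAt {U : Set V} (hU : IsOpen U) {f : V → W} (hf : ContDiffOn ℝ ∞ f U)
    {p : V} (hp : p ∈ U) : DifferentiableAt ℝ f p :=
  (hf.contDiffAt (hU.mem_nhds hp)).differentiableAt (by simp)

theorem contDiffOn_D {U : Set V} (hU : IsOpen U) {f : V → W} (hf : ContDiffOn ℝ ∞ f U) (w : V) :
    ContDiffOn ℝ ∞ (D w f) U :=
  (hf.fderiv_of_isOpen hU (by simp)).clm_apply contDiffOn_const

theorem contDiffOn_D_field {U : Set V} (hU : IsOpen U) {f : V → W} (hf : ContDiffOn ℝ ∞ f U)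
    {w : V → V} (hw : ContDiffOn ℝ ∞ w U) :
    ContDiffOn ℝ ∞ (fun p => D (w p) f p) U :=
  (hf.fderiv_of_isOpen hU (by simp)).clm_apply hw

theorem D_add_dir (v w : V) (f : V → W) (p : V) : D (v + w) f p = D v f p + D w f p := by
  simp [D]

theorem D_sub_dir (v w : V) (f : V → W) (p : V) : D (v - w) f p = D v f p - D w f p := by
  simp [D]

theorem D_smul_dir (c : ℝ) (w : V) (f : V → W) (p : V) : D (c • w) f p = c • D w f p := by
  simp [D]

theorem D_zero_dir (f : V → W) (p : V) : D 0 f p = 0 := by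
  simp [D]

theorem D_congr {U : Set V} (hU : IsOpen U) {f g : V → W} (h : EqOn f g U) (w : V) :
    EqOn (D w f) (D w g) U := fun p hp => by
  have : f =ᶠ[𝓝 p] g := h.eventuallyEq_of_mem (hU.mem_nhds hp)
  simp only [D, this.fderiv_eq]

theorem D_second {U : Set V} (hU : IsOpen U) {f : V → W} (hf : ContDiffOn ℝ ∞ f U) (v w : V)
    {p : V} (hp : p ∈ U) : D w (D v f) p = fderiv ℝ (fderiv ℝ f) p w v := by
  have h : DifferentiableAt ℝ (fderiv ℝ f) p :=
    ContDiffOn.diffAt hU (hf.fderiv_of_isOpen hU (by simp)) hp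
  have := h.hasFDerivAt.clm_apply (hasFDerivAt_const v p)
  unfold D
  erw [this.fderiv]
  simp

theorem D_comm {U : Set V} (hU : IsOpen U) {f : V → W} (hf : ContDiffOn ℝ ∞ f U) (v w : V)
    {p : V} (hp : p ∈ U) : D w (D v f) p = D v (D w f) p := by
  rw [D_second hU hf _ _ hp, D_second hU hf _ _ hp]
  exact ((hf.contDiffAt (hU.mem_nhds hp)).isSymmSndFDerivAt
    (by
      rw [minSmoothness_of_isRCLikeNormedField]; exact WithTop.coe_le_coe.2 le_top)).eq w v

theorem D_D_add {U : Set V} (hU : IsOpen U) {f : V → W} (hf : ContDiffOn ℝ ∞ f U) (u v w : V)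
    {p : V} (hp : p ∈ U) : D w (D (u + v) f) p = D w (D u f) p + D w (D v f) p := by
  simp only [D_second hU hf _ _ hp, map_add]

theorem D_D_smul {U : Set V} (hU : IsOpen U) {f : V → W} (hf : ContDiffOn ℝ ∞ f U) (c : ℝ)
    (v w : V) {p : V} (hp : p ∈ U) : D w (D (c • v) f) p = c • D w (D v f) p := by
  simp only [D_second hU hf _ _ hp, map_smul]

/-- Derivative of `q ↦ D (w q) f q` for a direction field `w`. -/
theorem D_field {U : Set V} (hU : IsOpen U) {f : V → W} (hf : ContDiffOn ℝ ∞ f U) {w : V → V}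
    {p : V} (hw : DifferentiableAt ℝ w p) (u : V) (hp : p ∈ U) :
    D u (fun q => D (w q) f q) p = D u (D (w p) f) p + D (D u w p) f p := by
  have h : DifferentiableAt ℝ (fderiv ℝ f) p :=
    ContDiffOn.diffAt hU (hf.fderiv_of_isOpen hU (by simp)) hp
  have := h.hasFDerivAt.clm_apply hw.hasFDerivAt
  rw [D_second hU hf _ _ hp]
  unfold D
  erw [this.fderiv]
  simp [add_comm]

theorem D_add {f g : V → W} {p : V} (hf : DifferentiableAt ℝ f p) (hg : DifferentiableAt ℝ g p)
    (w : V) : D w (fun q => f q + g q) p = D w f p + D w g p := by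
  simp [D, fderiv_fun_add hf hg]

theorem D_sub {f g : V → W} {p : V} (hf : DifferentiableAt ℝ f p) (hg : DifferentiableAt ℝ g p)
    (w : V) : D w (fun q => f q - g q) p = D w f p - D w g p := by
  simp [D, fderiv_fun_sub hf hg]

theorem D_smul {c : V → ℝ} {g : V → W} {p : V} (hc : DifferentiableAt ℝ c p)
    (hg : DifferentiableAt ℝ g p) (w : V) :
    D w (fun q => c q • g q) p = c p • D w g p + D w c p • g p := by
  simp [D, fderiv_fun_smul hc hg]

theorem D_mul {f g : V → ℝ} {p : V} (hf : DifferentiableAt ℝ f p) (hg : DifferentiableAt ℝ g p)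
    (w : V) : D w (fun q => f q * g q) p = f p * D w g p + D w f p * g p := by
  simp [D, fderiv_fun_mul hf hg]; ring

theorem D_const (c : W) (w : V) (p : V) : D w (fun _ => c) p = 0 := by
  simp [D]

theorem D_const_mul {f : V → ℝ} {p : V} (hf : DifferentiableAt ℝ f p) (c : ℝ) (w : V) :
    D w (fun q => c * f q) p = c * D w f p := by
  rw [D_mul (by fun_prop) hf, D_const]; simp

theorem D_sq {f : V → ℝ} {p : V} (hf : DifferentiableAt ℝ f p) (w : V) :
    D w (fun q => f q ^ 2) p = 2 * f p * D w f p := by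
  simp only [pow_two, D_mul hf hf]; ring

theorem D_clm (L : V →L[ℝ] W) (w : V) (p : V) : D w (fun q => L q) p = L w := by
  simp [D]

theorem D_clm_comp {X : Type*} [NormedAddCommGroup X] [NormedSpace ℝ X] (L : W →L[ℝ] X)
    {f : V → W} {p : V} (hf : DifferentiableAt ℝ f p) (w : V) :
    D w (fun q => L (f q)) p = L (D w f p) := by
  have := L.hasFDerivAt.comp p hf.hasFDerivAt
  unfold D
  erw [this.fderiv]; rfl

theorem hasDerivAt_line {f : V → W} {p : V} (hf : DifferentiableAt ℝ f p) (w : V) :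
    HasDerivAt (fun t : ℝ => f (p + t • w)) (D w f p) 0 := by
  have h1 : HasDerivAt (fun t : ℝ => p + t • w) w 0 := by
    simpa using ((hasDerivAt_id (0 : ℝ)).smul_const w).const_add p
  have h2 : HasFDerivAt f (fderiv ℝ f p) (p + (0 : ℝ) • w) := by simpa using hf.hasFDerivAt
  exact h2.comp_hasDerivAt 0 h1

/-- Reduces the explicit derivatives below to one-variable calculus: differentiability is known
beforehand from smoothness, so only the value along a line has to be computed. -/
theorem D_eq_of_line {f : V → W} {p w : V} {c : W} (hf : DifferentiableAt ℝ f p)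
    (h : HasDerivAt (fun t : ℝ => f (p + t • w)) c 0) : D w f p = c :=
  (hasDerivAt_line hf w).unique h

theorem D_eq_of_curve {f : V → W} {γ : ℝ → V} {w : V} {c : W} {t : ℝ}
    (hf : DifferentiableAt ℝ f (γ t)) (hγ : HasDerivAt γ w t)
    (h : HasDerivAt (fun t : ℝ => f (γ t)) c t) : D w f (γ t) = c :=
  (hf.hasFDerivAt.comp_hasDerivAt t hγ).unique h

end Directional

/-! ### Coordinate derivatives as directional derivatives on the product -/

variable {n : ℕ}

/-- A function of base point and tangent vector as a function on the product. -/
abbrev unc (f : E n → E n → ℝ) : E n × E n → ℝ := fun p => f p.1 p.2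

theorem vec_eq_sum (u : E n) : u = ∑ i, u i • EuclideanSpace.single i (1 : ℝ) := by
  ext j
  simp [Finset.sum_apply, Pi.single_apply]

theorem D_fst_eq_sum {W : Type*} [NormedAddCommGroup W] [NormedSpace ℝ W] (u : E n)
    (f : E n × E n → W) (p : E n × E n) :
    D (u, 0) f p = ∑ i, u i • D (EuclideanSpace.single i (1 : ℝ), 0) f p := by
  have h : ((u, 0) : E n × E n) = ∑ i, u i • (EuclideanSpace.single i (1 : ℝ), (0 : E n)) := by
    apply Prod.ext
    · simpa [Prod.fst_sum] using vec_eq_sum u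
    · simp [Prod.snd_sum]
  unfold D
  conv_lhs => rw [h, map_sum]
  exact Finset.sum_congr rfl fun i _ => map_smul _ _ _

theorem D_snd_eq_sum {W : Type*} [NormedAddCommGroup W] [NormedSpace ℝ W] (u : E n)
    (f : E n × E n → W) (p : E n × E n) :
    D (0, u) f p = ∑ i, u i • D (0, EuclideanSpace.single i (1 : ℝ)) f p := by
  have h : ((0, u) : E n × E n) = ∑ i, u i • ((0 : E n), EuclideanSpace.single i (1 : ℝ)) := by
    apply Prod.ext
    · simp [Prod.fst_sum]
    · simpa [Prod.snd_sum] using vec_eq_sum u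
  unfold D
  conv_lhs => rw [h, map_sum]
  exact Finset.sum_congr rfl fun i _ => map_smul _ _ _

theorem dx_eq_D {f : E n → E n → ℝ} {x y : E n} (h : DifferentiableAt ℝ (unc f) (x, y))
    (i : Fin n) : dx i f x y = D (EuclideanSpace.single i (1 : ℝ), 0) (unc f) (x, y) := by
  have h1 : HasFDerivAt (fun z : E n => (z, y)) (ContinuousLinearMap.inl ℝ (E n) (E n)) x :=
    hasFDerivAt_prodMk_left x y
  have := h.hasFDerivAt.comp x h1
  unfold dx D
  erw [this.fderiv]
  simp

theorem dy_eq_D {f : E n → E n → ℝ} {x y : E n} (h : DifferentiableAt ℝ (unc f) (x, y))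
    (i : Fin n) : dy i f x y = D (0, EuclideanSpace.single i (1 : ℝ)) (unc f) (x, y) := by
  have h1 : HasFDerivAt (fun z : E n => (x, z)) (ContinuousLinearMap.inr ℝ (E n) (E n)) y :=
    hasFDerivAt_prodMk_right x y
  have := h.hasFDerivAt.comp y h1
  unfold dy D
  erw [this.fderiv]
  simp

section Smooth

variable {U : Set (E n × E n)}

theorem eqOn_dx (hU : IsOpen U) {f : E n → E n → ℝ}
    (h : ContDiffOn ℝ ∞ (unc f) U) (i : Fin n) :
    EqOn (unc (dx i f)) (D (EuclideanSpace.single i (1 : ℝ), 0) (unc f)) U :=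
  fun _ hp => dx_eq_D (ContDiffOn.diffAt hU h hp) i

theorem eqOn_dy (hU : IsOpen U) {f : E n → E n → ℝ}
    (h : ContDiffOn ℝ ∞ (unc f) U) (i : Fin n) :
    EqOn (unc (dy i f)) (D (0, EuclideanSpace.single i (1 : ℝ)) (unc f)) U :=
  fun _ hp => dy_eq_D (ContDiffOn.diffAt hU h hp) i

theorem contDiffOn_dx (hU : IsOpen U) {f : E n → E n → ℝ}
    (h : ContDiffOn ℝ ∞ (unc f) U) (i : Fin n) :
    ContDiffOn ℝ ∞ (unc (dx i f)) U :=
  (contDiffOn_D hU h _).congr (eqOn_dx hU h i)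

theorem contDiffOn_dy (hU : IsOpen U) {f : E n → E n → ℝ}
    (h : ContDiffOn ℝ ∞ (unc f) U) (i : Fin n) :
    ContDiffOn ℝ ∞ (unc (dy i f)) U :=
  (contDiffOn_D hU h _).congr (eqOn_dy hU h i)

theorem sum_dx (hU : IsOpen U) {f : E n → E n → ℝ}
    (h : ContDiffOn ℝ ∞ (unc f) U) {p : E n × E n} (hp : p ∈ U)
    (u : E n) : ∑ i, u i * dx i f p.1 p.2 = D (u, 0) (unc f) p := by
  rw [D_fst_eq_sum]
  exact Finset.sum_congr rfl fun i _ => by rw [smul_eq_mul, ← eqOn_dx hU h i hp]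

theorem sum_dy (hU : IsOpen U) {f : E n → E n → ℝ}
    (h : ContDiffOn ℝ ∞ (unc f) U) {p : E n × E n} (hp : p ∈ U)
    (u : E n) : ∑ i, u i * dy i f p.1 p.2 = D (0, u) (unc f) p := by
  rw [D_snd_eq_sum]
  exact Finset.sum_congr rfl fun i _ => by rw [smul_eq_mul, ← eqOn_dy hU h i hp]

theorem sum_D_dy (hU : IsOpen U) {f : E n → E n → ℝ}
    (h : ContDiffOn ℝ ∞ (unc f) U) {p : E n × E n} (hp : p ∈ U)
    (w : E n × E n) (u : E n) :
    ∑ i, u i * D w (unc (dy i f)) p = D w (D (0, u) (unc f)) p := by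
  have h2 : D w (D (0, u) (unc f)) p =
      ∑ i, u i • D w (D (0, EuclideanSpace.single i (1 : ℝ)) (unc f)) p := by
    rw [D_comm hU h _ _ hp, D_snd_eq_sum]
    exact Finset.sum_congr rfl fun i _ => by rw [D_comm hU h _ _ hp]
  rw [h2]
  exact Finset.sum_congr rfl fun i _ => by
    rw [smul_eq_mul, D_congr hU (eqOn_dy hU h i) w hp]

theorem sum_dx_dy (hU : IsOpen U) {f : E n → E n → ℝ}
    (h : ContDiffOn ℝ ∞ (unc f) U) {p : E n × E n} (hp : p ∈ U)
    (w u : E n) : ∑ i, u i * ∑ j, w j * dx j (dy i f) p.1 p.2 = D (w, 0) (D (0, u) (unc f)) p := by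
  rw [← sum_D_dy hU h hp]
  exact Finset.sum_congr rfl fun i _ => by rw [sum_dx hU (contDiffOn_dy hU h i) hp]

theorem sum_dy_dy (hU : IsOpen U) {f : E n → E n → ℝ}
    (h : ContDiffOn ℝ ∞ (unc f) U) {p : E n × E n} (hp : p ∈ U)
    (w u : E n) : ∑ i, u i * ∑ j, w j * dy j (dy i f) p.1 p.2 = D (0, w) (D (0, u) (unc f)) p := by
  rw [← sum_D_dy hU h hp]
  exact Finset.sum_congr rfl fun i _ => by rw [sum_dy hU (contDiffOn_dy hU h i) hp]

end Smooth

/-! ### The fundamental tensor and the spray -/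

theorem contDiffOn_matrix_det {V ι : Type*} [NormedAddCommGroup V] [NormedSpace ℝ V] [Fintype ι]
    [DecidableEq ι] {U : Set V} {M : V → Matrix ι ι ℝ}
    (h : ∀ i j, ContDiffOn ℝ ∞ (fun p => M p i j) U) : ContDiffOn ℝ ∞ (fun p => (M p).det) U := by
  simp only [Matrix.det_apply']
  exact ContDiffOn.sum fun σ _ => contDiffOn_const.mul (contDiffOn_prod fun i _ => h _ _)

theorem contDiffOn_matrix_inv {V ι : Type*} [NormedAddCommGroup V] [NormedSpace ℝ V] [Fintype ι]
    [DecidableEq ι] {U : Set V} {M : V → Matrix ι ι ℝ}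
    (h : ∀ i j, ContDiffOn ℝ ∞ (fun p => M p i j) U) (hM : ∀ p ∈ U, (M p).det ≠ 0) (i j : ι) :
    ContDiffOn ℝ ∞ (fun p => (M p)⁻¹ i j) U := by
  simp only [Matrix.inv_def, Ring.inverse_eq_inv', Matrix.smul_apply, smul_eq_mul,
    Matrix.adjugate_apply]
  refine ((contDiffOn_matrix_det h).inv hM).mul (contDiffOn_matrix_det fun k l => ?_)
  by_cases hk : k = j
  · subst hk
    simp only [Matrix.updateRow_self]
    exact contDiffOn_const
  · simp only [Matrix.updateRow_ne hk]
    exact h k l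

/-- The square of `F` as a function on the product. -/
abbrev en (F : E n → E n → ℝ) : E n × E n → ℝ := unc (energy F)

/-- The vector of geodesic coefficients. -/
def sprayVec (F : E n → E n → ℝ) (p : E n × E n) : E n :=
  WithLp.toLp 2 fun i => spray F i p.1 p.2

theorem D_apply {G : E n × E n → E n} {p : E n × E n} (hG : DifferentiableAt ℝ G p)
    (w : E n × E n) (i : Fin n) : (D w G p) i = D w (fun q => G q i) p :=
  (D_clm_comp (EuclideanSpace.proj (𝕜 := ℝ) i : E n →L[ℝ] ℝ) hG w).symm

theorem fundInner_eq_of_contDiffOn {F : E n → E n → ℝ} {U : Set (E n × E n)} (hU : IsOpen U)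
    (he : ContDiffOn ℝ ∞ (en F) U) {p : E n × E n} (hp : p ∈ U) (u v : E n) :
    fundInner F p.1 p.2 u v = (1 / 2) * D (0, u) (D (0, v) (en F)) p := by
  rw [← sum_dy_dy hU he hp, Finset.mul_sum, fundInner, Finset.sum_comm]
  refine Finset.sum_congr rfl fun j _ => ?_
  rw [Finset.mul_sum, Finset.mul_sum]
  refine Finset.sum_congr rfl fun i _ => ?_
  simp only [fundTensor, Matrix.of_apply]
  ring

theorem fundInner_eq_dotProduct (F : E n → E n → ℝ) (x y u v : E n) :
    fundInner F x y u v = (fun i => u i) ⬝ᵥ (fundTensor F x y).mulVec (fun i => v i) := by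
  simp only [dotProduct, Matrix.mulVec, fundInner, Finset.mul_sum]
  exact Finset.sum_congr rfl fun i _ => Finset.sum_congr rfl fun j _ => by ring

theorem posDef_of_contDiffOn {F : E n → E n → ℝ} {U : Set (E n × E n)} (hU : IsOpen U)
    (he : ContDiffOn ℝ ∞ (en F) U) {p : E n × E n} (hp : p ∈ U)
    (hpos : ∀ u : E n, u ≠ 0 → 0 < D (0, u) (D (0, u) (en F)) p) :
    (fundTensor F p.1 p.2).PosDef := by
  refine Matrix.PosDef.of_dotProduct_mulVec_pos ?_ fun u hu => ?_
  · ext i j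
    have h : ∀ i j, dy i (dy j (energy F)) p.1 p.2 =
        D (0, EuclideanSpace.single i (1 : ℝ)) (D (0, EuclideanSpace.single j (1 : ℝ)) (en F)) p :=
      fun i j => (eqOn_dy hU (contDiffOn_dy hU he j) i hp).trans
        (D_congr hU (eqOn_dy hU he j) _ hp)
    simp only [Matrix.conjTranspose_apply, fundTensor, Matrix.of_apply, star_trivial, h]
    rw [D_comm hU he _ _ hp]
  · have h := fundInner_eq_of_contDiffOn hU he hp (WithLp.toLp 2 u) (WithLp.toLp 2 u)
    rw [fundInner_eq_dotProduct] at h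
    have hu' : (WithLp.toLp 2 u : E n) ≠ 0 := fun h0 =>
      hu (by ext i; exact congrArg (fun v : E n => v i) h0)
    rw [star_trivial]
    have := hpos _ hu'
    refine lt_of_lt_of_eq ?_ h.symm
    linarith

namespace IsFinslerOn

variable {F : E n → E n → ℝ} {U : Set (E n × E n)}

theorem contDiffOn_unc (hF : IsFinslerOn F U) : ContDiffOn ℝ ∞ (unc F) U := hF.smooth

theorem contDiffOn_en (hF : IsFinslerOn F U) : ContDiffOn ℝ ∞ (en F) U := hF.smooth.pow 2

theorem contDiffOn_fundTensor (hF : IsFinslerOn F U) (i j : Fin n) :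
    ContDiffOn ℝ ∞ (fun p : E n × E n => fundTensor F p.1 p.2 i j) U :=
  contDiffOn_const.mul
    (contDiffOn_dy hF.isOpen (contDiffOn_dy hF.isOpen hF.contDiffOn_en j) i)

theorem contDiffOn_spray (hF : IsFinslerOn F U) (i : Fin n) :
    ContDiffOn ℝ ∞ (unc (spray F i)) U := by
  refine contDiffOn_const.mul (ContDiffOn.sum fun l _ => ContDiffOn.mul ?_ (ContDiffOn.sub
    (ContDiffOn.sum fun m _ => ContDiffOn.mul ?_ ?_) ?_))
  · exact contDiffOn_matrix_inv hF.contDiffOn_fundTensor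
      (fun p hp => (hF.posDef p.1 p.2 hp).det_pos.ne') i l
  · exact contDiffOn_dx hF.isOpen (contDiffOn_dy hF.isOpen hF.contDiffOn_en l) m
  · exact ((EuclideanSpace.proj (𝕜 := ℝ) m : E n →L[ℝ] ℝ).contDiff.comp contDiff_snd).contDiffOn
  · exact contDiffOn_dx hF.isOpen hF.contDiffOn_en l

theorem contDiffOn_sprayVec (hF : IsFinslerOn F U) : ContDiffOn ℝ ∞ (sprayVec F) U :=
  (contDiffOn_euclidean).2 fun i => hF.contDiffOn_spray i

theorem fundInner_eq (hF : IsFinslerOn F U) {p : E n × E n} (hp : p ∈ U) (u v : E n) :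
    fundInner F p.1 p.2 u v = (1 / 2) * D (0, u) (D (0, v) (en F)) p :=
  fundInner_eq_of_contDiffOn hF.isOpen hF.contDiffOn_en hp u v

theorem fundInner_pos (hF : IsFinslerOn F U) {p : E n × E n} (hp : p ∈ U) {u : E n} (hu : u ≠ 0) :
    0 < fundInner F p.1 p.2 u u := by
  have h := (hF.posDef p.1 p.2 hp).dotProduct_mulVec_pos (x := fun i => u i)
    (fun h => hu (by ext i; exact congrFun h i))
  rwa [star_trivial, ← fundInner_eq_dotProduct] at h

/-- The Euler–Lagrange equations. -/
theorem euler_lagrange (hF : IsFinslerOn F U) {p : E n × E n} (hp : p ∈ U) (u : E n) :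
    fundInner F p.1 p.2 (sprayVec F p) u =
      (1 / 4) * (D (p.2, 0) (D (0, u) (en F)) p - D (u, 0) (en F) p) := by
  set g := fundTensor F p.1 p.2 with hg
  have hdet : IsUnit g.det := (hF.posDef p.1 p.2 hp).det_pos.ne'.isUnit
  have hsymm : g.transpose = g := by
    have := (hF.posDef p.1 p.2 hp).isHermitian
    rwa [Matrix.IsHermitian, Matrix.conjTranspose_eq_transpose_of_trivial] at this
  set b : Fin n → ℝ := fun l =>
    ∑ m, dx m (dy l (energy F)) p.1 p.2 * p.2 m - dx l (energy F) p.1 p.2 with hb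
  have h1 : (fun i => sprayVec F p i) = (1 / 4 : ℝ) • (g⁻¹.mulVec b) := by
    funext i
    rfl
  have h2 : g.mulVec (fun i => sprayVec F p i) = (1 / 4 : ℝ) • b := by
    rw [h1, Matrix.mulVec_smul, Matrix.mulVec_mulVec, Matrix.mul_nonsing_inv _ hdet,
      Matrix.one_mulVec]
  rw [← sum_dx_dy hF.isOpen hF.contDiffOn_en hp, ← sum_dx hF.isOpen hF.contDiffOn_en hp,
    ← Finset.sum_sub_distrib, Finset.mul_sum, fundInner, Finset.sum_comm]
  refine Finset.sum_congr rfl fun j _ => ?_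
  have h3 : ∑ i, g i j * sprayVec F p i = (1 / 4 : ℝ) * b j := by
    have := congrFun h2 j
    rw [← hsymm] at this
    simpa [Matrix.mulVec, dotProduct, Matrix.transpose_apply] using this
  rw [← hg, ← Finset.sum_mul, h3, hb]
  simp only [mul_comm (p.2 _)]
  ring

theorem sprayVec_unique (hF : IsFinslerOn F U) {p : E n × E n} (hp : p ∈ U) {w : E n}
    (h : ∀ u, fundInner F p.1 p.2 w u =
      (1 / 4) * (D (p.2, 0) (D (0, u) (en F)) p - D (u, 0) (en F) p)) : sprayVec F p = w := by
  by_contra hne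
  have h1 := hF.fundInner_pos hp (sub_ne_zero.2 hne)
  have h2 := hF.euler_lagrange hp (sprayVec F p - w)
  rw [← h, hF.fundInner_eq hp, hF.fundInner_eq hp] at h2
  rw [hF.fundInner_eq hp, show ((0 : E n), sprayVec F p - w) = (0, sprayVec F p) - (0, w) by simp,
    D_sub_dir] at h1
  rw [show ((0 : E n), sprayVec F p - w) = (0, sprayVec F p) - (0, w) by simp] at h2
  linarith

end IsFinslerOn

/-! ### Euler's identities for homogeneous functions -/

section Homogeneous

variable {U : Set (E n × E n)}

theorem D_euler {f : E n × E n → ℝ} {p : E n × E n} (hf : DifferentiableAt ℝ f p) (d : ℕ)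
    (h : ∀ c : ℝ, 0 < c → f (p.1, c • p.2) = c ^ d * f p) : D (0, p.2) f p = d * f p := by
  refine D_eq_of_line hf ?_
  have h1 : HasDerivAt (fun t : ℝ => (1 + t) ^ d * f p) (d * f p) 0 := by
    have := (((hasDerivAt_id (0 : ℝ)).const_add 1).pow d).mul_const (f p)
    simpa using this
  refine h1.congr_of_eventuallyEq ?_
  filter_upwards [lt_mem_nhds (show (-1 : ℝ) < 0 by norm_num)] with t ht
  rw [← h (1 + t) (by linarith)]
  congr 1
  apply Prod.ext
  · simp
  · simp [add_smul]

theorem D_snd_field {w : E n × E n} {p : E n × E n} :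
    D w (fun q : E n × E n => ((0 : E n), q.2)) p = (0, w.2) :=
  D_clm ((ContinuousLinearMap.inr ℝ (E n) (E n)).comp (ContinuousLinearMap.snd ℝ (E n) (E n))) w p

/-- Differentiate Euler's identity along w. The extra term comes from the motion of the direction
field (0, y) itself. -/
theorem D_euler_D (hU : IsOpen U) {f : E n × E n → ℝ} (hf : ContDiffOn ℝ ∞ f U) (d : ℝ)
    (h : ∀ p ∈ U, D (0, p.2) f p = d * f p) {p : E n × E n} (hp : p ∈ U) (w : E n × E n) :
    D (0, p.2) (D w f) p = d * D w f p - D (0, w.2) f p := by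
  have h1 : D w (fun q => D (0, q.2) f q) p = D w (fun q => d * f q) p :=
    D_congr hU (fun q hq => h q hq) w hp
  rw [D_const_mul (ContDiffOn.diffAt hU hf hp),
    D_field (w := fun q : E n × E n => ((0 : E n), q.2)) hU hf (by fun_prop) w hp,
    D_snd_field, D_comm hU hf _ _ hp] at h1
  linarith

end Homogeneous

/-! ### Riemann curvature and the horizontal distribution -/

/-- The spray `(y, -2G)` as a vector field. -/
def sprayField (F : E n → E n → ℝ) (p : E n × E n) : E n × E n :=
  (p.2, (-2 : ℝ) • sprayVec F p)

/-- The Riemann curvature in coordinate free form. -/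
def riemannVec (F : E n → E n → ℝ) (p : E n × E n) (u : E n) : E n :=
  (2 : ℝ) • D (u, 0) (sprayVec F) p - D (sprayField F p) (D (0, u) (sprayVec F)) p
    - D (0, D (0, u) (sprayVec F) p) (sprayVec F) p

namespace IsFinslerOn

variable {F : E n → E n → ℝ} {U : Set (E n × E n)}

theorem D_euler_unc (hF : IsFinslerOn F U) {p : E n × E n} (hp : p ∈ U) :
    D (0, p.2) (unc F) p = unc F p := by
  have := D_euler (ContDiffOn.diffAt hF.isOpen hF.contDiffOn_unc hp) 1
    (fun c hc => by simpa using hF.homogeneous p.1 p.2 hp c hc)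
  simpa using this

theorem D_euler_en (hF : IsFinslerOn F U) {p : E n × E n} (hp : p ∈ U) :
    D (0, p.2) (en F) p = 2 * en F p := by
  have := D_euler (ContDiffOn.diffAt hF.isOpen hF.contDiffOn_en hp) 2
    (fun c hc => by
      change F _ _ ^ 2 = _ * F _ _ ^ 2
      rw [hF.homogeneous p.1 p.2 hp c hc, mul_pow])
  simpa using this

theorem D_euler_D_unc (hF : IsFinslerOn F U) {p : E n × E n} (hp : p ∈ U) (u : E n) :
    D (0, p.2) (D (0, u) (unc F)) p = 0 := by
  have := D_euler_D hF.isOpen hF.contDiffOn_unc 1 (fun q hq => by rw [hF.D_euler_unc hq, one_mul])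
    hp (0, u)
  rw [this]; ring

theorem D_euler_D_en (hF : IsFinslerOn F U) {p : E n × E n} (hp : p ∈ U) (u : E n) :
    D (0, p.2) (D (0, u) (en F)) p = D (0, u) (en F) p := by
  rw [D_euler_D hF.isOpen hF.contDiffOn_en 2 (fun q hq => hF.D_euler_en hq) hp (0, u)]
  ring

theorem fundInner_self_right (hF : IsFinslerOn F U) {p : E n × E n} (hp : p ∈ U) (u : E n) :
    fundInner F p.1 p.2 p.2 u = (1 / 2) * D (0, u) (en F) p := by
  rw [hF.fundInner_eq hp, hF.D_euler_D_en hp]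

theorem fundInner_self_self (hF : IsFinslerOn F U) {p : E n × E n} (hp : p ∈ U) :
    fundInner F p.1 p.2 p.2 p.2 = en F p := by
  rw [hF.fundInner_self_right hp, hF.D_euler_en hp]; ring

theorem contDiffOn_sprayField (hF : IsFinslerOn F U) : ContDiffOn ℝ ∞ (sprayField F) U :=
  contDiffOn_snd.prodMk (hF.contDiffOn_sprayVec.const_smul (-2 : ℝ))

theorem D_sprayField (hF : IsFinslerOn F U) {p : E n × E n} (hp : p ∈ U) (w : E n × E n) :
    D w (sprayField F) p = (w.2, (-2 : ℝ) • D w (sprayVec F) p) := by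
  have h := ContDiffOn.diffAt hF.isOpen hF.contDiffOn_sprayVec hp
  have h1 := (hasFDerivAt_snd (𝕜 := ℝ) (p := p)).prodMk (h.hasFDerivAt.const_smul (-2 : ℝ))
  unfold D
  erw [h1.fderiv]
  rfl

theorem D_sprayField_D_en (hF : IsFinslerOn F U) {p : E n × E n} (hp : p ∈ U) (u : E n) :
    D (sprayField F p) (D (0, u) (en F)) p = D (u, 0) (en F) p := by
  have h := hF.euler_lagrange hp u
  rw [hF.fundInner_eq hp] at h
  have : sprayField F p = (p.2, 0) + (-2 : ℝ) • (0, sprayVec F p) := by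
    simp [sprayField]
  rw [this, D_add_dir, D_smul_dir, smul_eq_mul]
  linarith

/-- Conservation of energy along geodesics: apply the spray to Euler's identity for F² and insert
the Euler–Lagrange equations. -/
theorem D_sprayField_en (hF : IsFinslerOn F U) {p : E n × E n} (hp : p ∈ U) :
    D (sprayField F p) (en F) p = 0 := by
  have h1 : D (sprayField F p) (fun q => D (0, q.2) (en F) q) p =
      D (sprayField F p) (fun q => 2 * en F q) p :=
    D_congr hF.isOpen (fun q hq => hF.D_euler_en hq) _ hp
  rw [D_const_mul (ContDiffOn.diffAt hF.isOpen hF.contDiffOn_en hp),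
    D_field (w := fun q : E n × E n => ((0 : E n), q.2)) hF.isOpen hF.contDiffOn_en (by fun_prop)
      _ hp, D_snd_field, hF.D_sprayField_D_en hp, ← D_add_dir] at h1
  have : ((p.2, 0) + (0, (sprayField F p).2) : E n × E n) = sprayField F p := by
    simp [sprayField]
  rw [this] at h1
  linarith

/-- The square of a Finsler metric is constant along the horizontal distribution. -/
theorem D_fst_en (hF : IsFinslerOn F U) {p : E n × E n} (hp : p ∈ U) (u : E n) :
    D (u, 0) (en F) p = D (0, D (0, u) (sprayVec F) p) (en F) p := by
  have h1 : D (0, u) (fun q => D (sprayField F q) (en F) q) p = D (0, u) (fun _ => (0 : ℝ)) p :=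
    D_congr hF.isOpen (fun q hq => hF.D_sprayField_en hq) _ hp
  rw [D_const, D_field hF.isOpen hF.contDiffOn_en
    (ContDiffOn.diffAt hF.isOpen hF.contDiffOn_sprayField hp) _ hp, hF.D_sprayField hp,
    D_comm hF.isOpen hF.contDiffOn_en _ _ hp, hF.D_sprayField_D_en hp,
    show ((((0 : E n), u) : E n × E n).2, (-2 : ℝ) • D (0, u) (sprayVec F) p) =
      (u, 0) + (-2 : ℝ) • ((0 : E n), D (0, u) (sprayVec F) p) by simp,
    D_add_dir, D_smul_dir, smul_eq_mul] at h1
  linarith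

/-- This is g(R(u), y) = 0. Let S be the spray field and N u the derivative of G along (0, u).
Differentiate S(F²) = 0 along (u, 0), and differentiate D_{(u,0)}F² = D_{(0,N u)}F² along S.
Eliminating the common term S(D_{(u,0)}F²) leaves exactly the derivative of F² along (0, R(u)). -/
theorem D_riemannVec_en (hF : IsFinslerOn F U) {p : E n × E n} (hp : p ∈ U) (u : E n) :
    D (0, riemannVec F p u) (en F) p = 0 := by
  have hU := hF.isOpen
  have hG := hF.contDiffOn_sprayVec
  have hN := contDiffOn_D hU hG (0, u)
  have h1 : D (u, 0) (fun q => D (sprayField F q) (en F) q) p = D (u, 0) (fun _ => (0 : ℝ)) p :=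
    D_congr hU (fun q hq => hF.D_sprayField_en hq) _ hp
  rw [D_const, D_field hU hF.contDiffOn_en
    (ContDiffOn.diffAt hU hF.contDiffOn_sprayField hp) _ hp, hF.D_sprayField hp,
    D_comm hU hF.contDiffOn_en _ _ hp] at h1
  have h2 : D (sprayField F p) (D (u, 0) (en F)) p =
      D (sprayField F p) (fun q => D (0, D (0, u) (sprayVec F) q) (en F) q) p :=
    D_congr hU (fun q hq => hF.D_fst_en hq u) _ hp
  have h3 : DifferentiableAt ℝ (fun q => ((0 : E n), D (0, u) (sprayVec F) q)) p :=
    (differentiableAt_const _).prodMk (ContDiffOn.diffAt hU hN hp)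
  have h4 : D (sprayField F p) (fun q => ((0 : E n), D (0, u) (sprayVec F) q)) p =
      (0, D (sprayField F p) (D (0, u) (sprayVec F)) p) :=
    D_clm_comp (ContinuousLinearMap.inr ℝ (E n) (E n)) (ContDiffOn.diffAt hU hN hp) _
  rw [D_field (w := fun q => ((0 : E n), D (0, u) (sprayVec F) q)) hU hF.contDiffOn_en h3 _ hp,
    hF.D_sprayField_D_en hp, hF.D_fst_en hp, h4] at h2
  have h5 : ((0 : E n), riemannVec F p u) =
      (2 : ℝ) • ((0 : E n), D (u, 0) (sprayVec F) p)
        - (0, D (sprayField F p) (D (0, u) (sprayVec F)) p)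
        - (0, D (0, D (0, u) (sprayVec F) p) (sprayVec F) p) := by
    simp [riemannVec]
  rw [h5, D_sub_dir, D_sub_dir, D_smul_dir, smul_eq_mul]
  rw [show ((((u, (0 : E n)) : E n × E n).2, (-2 : ℝ) • D (u, 0) (sprayVec F) p)) =
      (-2 : ℝ) • ((0 : E n), D (u, 0) (sprayVec F) p) by simp, D_smul_dir, smul_eq_mul] at h1
  linarith

theorem riemannApply_eq (hF : IsFinslerOn F U) {p : E n × E n} (hp : p ∈ U) (u : E n) :
    riemannApply F p.1 p.2 u = riemannVec F p u := by
  have hU := hF.isOpen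
  have hG := hF.contDiffOn_sprayVec
  have hN := contDiffOn_D hU hG (0, u)
  have hGd := ContDiffOn.diffAt hU hG hp
  have hs := hF.contDiffOn_spray
  ext i
  have e1 : (D (u, 0) (sprayVec F) p) i = ∑ m, u m * dx m (spray F i) p.1 p.2 := by
    rw [D_apply hGd, sum_dx hU (hs i) hp]; rfl
  have e2 : ∀ w, (D w (D (0, u) (sprayVec F)) p) i = D w (D (0, u) (unc (spray F i))) p := by
    intro w
    rw [D_apply (ContDiffOn.diffAt hU hN hp)]
    exact D_congr hU (fun q hq => D_apply (ContDiffOn.diffAt hU hG hq) _ _) _ hp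
  have e3 : (D (sprayField F p) (D (0, u) (sprayVec F)) p) i =
      ∑ m, u m * ∑ j, p.2 j * dx j (dy m (spray F i)) p.1 p.2
      - 2 * ∑ m, u m * ∑ j, spray F j p.1 p.2 * dy j (dy m (spray F i)) p.1 p.2 := by
    have : sprayField F p = (p.2, 0) + (-2 : ℝ) • (0, sprayVec F p) := by
      simp [sprayField]
    rw [e2, this, D_add_dir, D_smul_dir, smul_eq_mul, sum_dx_dy hU (hs i) hp]
    have := sum_dy_dy hU (hs i) hp (sprayVec F p) u
    rw [← this]
    simp only [sprayVec]
    ring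
  have e4 : (D (0, D (0, u) (sprayVec F) p) (sprayVec F) p) i =
      ∑ j, (∑ m, u m * dy m (spray F j) p.1 p.2) * dy j (spray F i) p.1 p.2 := by
    rw [D_apply hGd]
    change D _ (unc (spray F i)) p = _
    rw [← sum_dy hU (hs i) hp]
    refine Finset.sum_congr rfl fun j _ => ?_
    rw [D_apply hGd, sum_dy hU (hs j) hp]; rfl
  simp only [riemannVec, PiLp.sub_apply, PiLp.smul_apply, smul_eq_mul, e1, e3, e4, riemannApply,
    riemann]
  simp only [Finset.sum_mul, sub_mul, add_mul, Finset.sum_sub_distrib, Finset.sum_add_distrib,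
    Finset.mul_sum, mul_assoc]
  rw [Finset.sum_comm (f := fun (j m : Fin n) =>
    u m * (dy m (spray F j) p.1 p.2 * dy j (spray F i) p.1 p.2))]
  rw [sub_sub_eq_add_sub]
  congr 1
  · rw [sub_add_eq_add_sub]
    congr 1
    · congr 1
      · exact Finset.sum_congr rfl fun m _ => by ring
      · exact Finset.sum_congr rfl fun m _ => Finset.sum_congr rfl fun j _ => by ring
    · exact Finset.sum_congr rfl fun m _ => Finset.sum_congr rfl fun j _ => by ring
  · exact Finset.sum_congr rfl fun m _ => Finset.sum_congr rfl fun j _ => by ring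

end IsFinslerOn

/-! ### Invariants of a pair of vectors; density of good pairs -/

/-- `|x|²`. -/
def qa (p : E n × E n) : ℝ := inner ℝ p.1 p.1

/-- `⟨x, y⟩`. -/
def qv (p : E n × E n) : ℝ := inner ℝ p.1 p.2

/-- `|y|²`. -/
def qb (p : E n × E n) : ℝ := inner ℝ p.2 p.2

/-- The Gram determinant of `x` and `y`. -/
def gram (p : E n × E n) : ℝ := qa p * qb p - qv p ^ 2

/-- The area `√(|x|²|y|² - ⟨x, y⟩²)` of the parallelogram spanned by `x` and `y`. -/
def qA (p : E n × E n) : ℝ := √(gram p)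

theorem contDiff_qa : ContDiff ℝ ∞ (qa (n := n)) := contDiff_fst.inner ℝ contDiff_fst
theorem contDiff_qv : ContDiff ℝ ∞ (qv (n := n)) := contDiff_fst.inner ℝ contDiff_snd
theorem contDiff_qb : ContDiff ℝ ∞ (qb (n := n)) := contDiff_snd.inner ℝ contDiff_snd
theorem contDiff_gram : ContDiff ℝ ∞ (gram (n := n)) :=
  (contDiff_qa.mul contDiff_qb).sub (contDiff_qv.pow 2)

/-- The pairs in `U` for which `⟨x, y⟩ ≠ 0` and `x, y` are linearly independent. -/
def good (U : Set (E n × E n)) : Set (E n × E n) := {p | p ∈ U ∧ qv p ≠ 0 ∧ 0 < gram p}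

theorem good_subset (U : Set (E n × E n)) : good U ⊆ U := fun _ h => h.1

theorem isOpen_good {U : Set (E n × E n)} (hU : IsOpen U) : IsOpen (good U) := by
  have h1 : IsOpen {p : E n × E n | qv p ≠ 0} :=
    isOpen_ne_fun contDiff_qv.continuous continuous_const
  have h2 : IsOpen {p : E n × E n | 0 < gram p} :=
    isOpen_lt continuous_const contDiff_gram.continuous
  exact hU.inter (h1.inter h2)

theorem exists_orthogonal (S : Finset (E n)) (hS : S.card < n) :
    ∃ e : E n, e ≠ 0 ∧ ∀ w ∈ S, inner ℝ w e = 0 := by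
  have h1 : Module.finrank ℝ (Submodule.span ℝ (S : Set (E n))) < n :=
    (finrank_span_finset_le_card S).trans_lt hS
  have h2 := (Submodule.span ℝ (S : Set (E n))).finrank_add_finrank_orthogonal
  rw [finrank_euclideanSpace_fin] at h2
  have h3 : (Submodule.span ℝ (S : Set (E n)))ᗮ ≠ ⊥ := by
    intro h
    rw [h, finrank_bot] at h2
    omega
  obtain ⟨e, he, hne⟩ := Submodule.exists_mem_ne_zero_of_ne_bot h3
  exact ⟨e, hne, fun w hw => he w (Submodule.subset_span hw)⟩

theorem eventually_add_mul_ne_zero (c : ℝ) {d : ℝ} (hd : d ≠ 0) :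
    ∀ᶠ t : ℝ in 𝓝[≠] 0, c + t * d ≠ 0 := by
  by_cases hc : c = 0
  · filter_upwards [self_mem_nhdsWithin] with t ht
    simpa [hc] using ⟨ht, hd⟩
  · have : Tendsto (fun t : ℝ => c + t * d) (𝓝 0) (𝓝 c) := by
      have : Continuous (fun t : ℝ => c + t * d) := by fun_prop
      simpa using this.tendsto 0
    exact (this.eventually_ne hc).filter_mono nhdsWithin_le_nhds

/-- The vector e detects the part of x transverse to y: bx - vy has inner product b⟨x,e⟩ ≠ 0 with e,
and its square length is b times the Gram determinant. -/
theorem gram_pos_of_orthogonal {p : E n × E n} {e : E n} (hy : p.2 ≠ 0)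
    (h1 : inner ℝ p.2 e = 0) (h2 : inner ℝ p.1 e ≠ 0) : 0 < gram p := by
  have hb : 0 < qb p := real_inner_self_pos.2 hy
  set w : E n := qb p • p.1 - qv p • p.2 with hw
  have hwe : inner ℝ w e = qb p * inner ℝ p.1 e := by
    rw [hw, inner_sub_left, real_inner_smul_left, real_inner_smul_left, h1]; ring
  have hw0 : w ≠ 0 := by
    intro h
    rw [h, inner_zero_left] at hwe
    exact mul_ne_zero hb.ne' h2 hwe.symm
  have hww : inner ℝ w w = qb p * gram p := by
    simp only [hw, inner_sub_left, inner_sub_right, real_inner_smul_left, real_inner_smul_right,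
      gram, qa, qv, qb, real_inner_comm p.1 p.2]
    ring
  exact pos_of_mul_pos_right (hww ▸ real_inner_self_pos.2 hw0) hb.le

/-- In dimension at least two a continuous function that vanishes on the good pairs vanishes. -/
theorem eq_zero_of_good {U : Set (E n × E n)} (hU : IsOpen U) (hne : ∀ p ∈ U, p.2 ≠ 0)
    (hn : 2 ≤ n) {g : E n × E n → ℝ} (hg : ContinuousOn g U) (h0 : ∀ p ∈ good U, g p = 0)
    {p : E n × E n} (hp : p ∈ U) : g p = 0 := by
  obtain ⟨e, he, heo⟩ := exists_orthogonal {p.2} (by simp; omega)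
  have hye : inner ℝ p.2 e = 0 := heo _ (by simp)
  have hb : 0 < qb p := real_inner_self_pos.2 (hne p hp)
  -- Move x along y + e with e ⟂ y. Then v changes at rate b > 0 and ⟨x,e⟩ at rate |e|² > 0, so both
  -- are nonzero for all small t ≠ 0, and the moved pair is good.
  have hpath : Tendsto (fun t : ℝ => p + t • ((p.2 + e, 0) : E n × E n)) (𝓝 0) (𝓝 p) := by
    have : Continuous (fun t : ℝ => p + t • ((p.2 + e, 0) : E n × E n)) := by fun_prop
    simpa using this.tendsto 0
  have hlim := ((hg.continuousAt (hU.mem_nhds hp)).tendsto.comp hpath).mono_left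
    (nhdsWithin_le_nhds (s := {0}ᶜ))
  refine tendsto_nhds_unique hlim (tendsto_const_nhds.congr' ?_)
  filter_upwards [eventually_add_mul_ne_zero (qv p) hb.ne',
    eventually_add_mul_ne_zero (inner ℝ p.1 e) (real_inner_self_pos.2 he).ne',
    (hpath.eventually_mem (hU.mem_nhds hp)).filter_mono nhdsWithin_le_nhds] with t h1 h2 h3
  refine (h0 _ ⟨h3, ?_, gram_pos_of_orthogonal (e := e) ?_ ?_ ?_⟩).symm
  · have : qv (p + t • ((p.2 + e, 0) : E n × E n)) = qv p + t * qb p := by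
      simp only [qv, qb, Prod.fst_add, Prod.snd_add, Prod.smul_fst, Prod.smul_snd, smul_zero,
        add_zero, inner_add_left, real_inner_smul_left, real_inner_comm p.2 e, hye]
    rwa [this]
  · simpa using hne p hp
  · simpa using hye
  · simpa [inner_add_left, real_inner_smul_left, hye] using h2

/-! ### From good pairs to all of U: scalar curvature and straight geodesics -/

namespace IsFinslerOn

variable {F : E n → E n → ℝ} {U : Set (E n × E n)}

theorem contDiffOn_riemannVec (hF : IsFinslerOn F U) (u : E n) :
    ContDiffOn ℝ ∞ (fun p => riemannVec F p u) U := by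
  have hU := hF.isOpen
  have hG := hF.contDiffOn_sprayVec
  have hN := contDiffOn_D hU hG (0, u)
  exact (((contDiffOn_D hU hG _).const_smul _).sub
    (contDiffOn_D_field hU hN hF.contDiffOn_sprayField)).sub
    (contDiffOn_D_field hU hG (contDiffOn_const.prodMk hN))

theorem contDiffOn_fundInner (hF : IsFinslerOn F U) {v w : E n × E n → E n}
    (hv : ContDiffOn ℝ ∞ v U) (hw : ContDiffOn ℝ ∞ w U) :
    ContDiffOn ℝ ∞ (fun p => fundInner F p.1 p.2 (v p) (w p)) U :=
  ContDiffOn.sum fun i _ => ContDiffOn.sum fun j _ =>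
    ((hF.contDiffOn_fundTensor i j).mul (contDiffOn_euclidean.1 hv i)).mul
      (contDiffOn_euclidean.1 hw j)

theorem fundInner_sub_smul (hF : IsFinslerOn F U) {p : E n × E n} (hp : p ∈ U) (u : E n) (c : ℝ) :
    fundInner F p.1 p.2 (u - c • p.2) (u - c • p.2) = fundInner F p.1 p.2 u u
      - 2 * c * fundInner F p.1 p.2 p.2 u + c ^ 2 * fundInner F p.1 p.2 p.2 p.2 := by
  have hU := hF.isOpen
  have he := hF.contDiffOn_en
  have e1 : ((0 : E n), u - c • p.2) = (0, u) + (-c) • (0, p.2) := by simp [sub_eq_add_neg]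
  rw [hF.fundInner_eq hp, hF.fundInner_eq hp, hF.fundInner_eq hp, hF.fundInner_eq hp, e1,
    D_add_dir, D_smul_dir, D_D_add hU he _ _ _ hp, D_D_add hU he _ _ _ hp,
    D_D_smul hU he _ _ _ hp, D_D_smul hU he _ _ _ hp, D_comm hU he (0, p.2) (0, u) hp]
  simp only [smul_eq_mul]
  ring

/-- Gram–Schmidt for g: subtract from u its g-projection to y; independence makes the remainder
nonzero. -/
theorem flag_denominator_pos (hF : IsFinslerOn F U) {p : E n × E n} (hp : p ∈ U) {u : E n}
    (hu : LinearIndependent ℝ ![p.2, u]) :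
    0 < fundInner F p.1 p.2 p.2 p.2 * fundInner F p.1 p.2 u u - fundInner F p.1 p.2 p.2 u ^ 2 := by
  have hy : 0 < fundInner F p.1 p.2 p.2 p.2 := hF.fundInner_pos hp (hF.ne_zero _ _ hp)
  set c := fundInner F p.1 p.2 p.2 u / fundInner F p.1 p.2 p.2 p.2 with hc
  have h1 : u - c • p.2 ≠ 0 := by
    intro h
    have := LinearIndependent.pair_iff.1 hu (-c) 1 (by rw [← h]; module)
    simp at this
  have h2 := mul_pos hy (hF.fundInner_pos hp h1)
  rw [hF.fundInner_sub_smul hp] at h2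
  have h3 : c * fundInner F p.1 p.2 p.2 p.2 = fundInner F p.1 p.2 p.2 u := by
    rw [hc]; field_simp
  nlinarith [h2, h3]

/-- The relation g(R(u), y) = 0 expresses τ through ρ. After this substitution the numerator is ρ
times the denominator, so the flag curvature is ρ/F² for every plane. -/
theorem flag_numerator_eq (hF : IsFinslerOn F U) {p : E n × E n} (hp : p ∈ U) {u : E n} {ρ τ : ℝ}
    (h : riemannVec F p u = ρ • u + τ • p.2) :
    fundInner F p.1 p.2 (riemannApply F p.1 p.2 u) u * fundInner F p.1 p.2 p.2 p.2 =
      ρ * (fundInner F p.1 p.2 p.2 p.2 * fundInner F p.1 p.2 u u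
        - fundInner F p.1 p.2 p.2 u ^ 2) := by
  have e1 : ((0 : E n), ρ • u + τ • p.2) = ρ • (0, u) + τ • (0, p.2) := by simp
  have h1 := hF.D_riemannVec_en hp u
  rw [h, e1, D_add_dir, D_smul_dir, D_smul_dir, hF.D_euler_en hp, smul_eq_mul, smul_eq_mul] at h1
  rw [hF.riemannApply_eq hp, h, hF.fundInner_self_self hp, hF.fundInner_self_right hp,
    hF.fundInner_eq hp, hF.fundInner_eq hp, e1, D_add_dir, D_smul_dir, D_smul_dir,
    hF.D_euler_D_en hp, smul_eq_mul, smul_eq_mul]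
  linear_combination (1 / 4) * (D (0, u) (en F) p) * h1

/-- Equality of the flag curvatures for two planes is cross-multiplied into the vanishing of a
continuous function on U. It therefore passes from good pairs to all pairs, with no need to extend
ρ. In dimension less than two there are no flags. -/
theorem hasScalarFlagCurvature_of_good (hF : IsFinslerOn F U)
    (h : ∀ p ∈ good U, ∃ ρ : ℝ, ∀ u, ∃ τ : ℝ, riemannVec F p u = ρ • u + τ • p.2) :
    HasScalarFlagCurvature F U := by
  by_cases hn : 2 ≤ n
  swap
  · refine ⟨0, fun x y _ u hu => ?_⟩
    have := hu.fintype_card_le_finrank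
    simp at this
    omega
  have hcont : ∀ u, ContinuousOn (fun p : E n × E n =>
      fundInner F p.1 p.2 (riemannApply F p.1 p.2 u) u) U := fun u =>
    ((hF.contDiffOn_fundInner (hF.contDiffOn_riemannVec u) contDiffOn_const).congr
      fun p hp => by rw [hF.riemannApply_eq hp]).continuousOn
  have hden : ∀ u, ContinuousOn (fun p : E n × E n => fundInner F p.1 p.2 p.2 p.2 *
      fundInner F p.1 p.2 u u - fundInner F p.1 p.2 p.2 u ^ 2) U := fun u =>
    (((hF.contDiffOn_fundInner contDiffOn_snd contDiffOn_snd).mul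
      (hF.contDiffOn_fundInner contDiffOn_const contDiffOn_const)).sub
      ((hF.contDiffOn_fundInner contDiffOn_snd contDiffOn_const).pow 2)).continuousOn
  have key : ∀ p ∈ U, ∀ u u' : E n,
      fundInner F p.1 p.2 (riemannApply F p.1 p.2 u) u * (fundInner F p.1 p.2 p.2 p.2 *
        fundInner F p.1 p.2 u' u' - fundInner F p.1 p.2 p.2 u' ^ 2) -
      fundInner F p.1 p.2 (riemannApply F p.1 p.2 u') u' * (fundInner F p.1 p.2 p.2 p.2 *
        fundInner F p.1 p.2 u u - fundInner F p.1 p.2 p.2 u ^ 2) = 0 := by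
    intro p hp u u'
    refine eq_zero_of_good hF.isOpen (fun p hp => hF.ne_zero _ _ hp) hn
      (((hcont u).mul (hden u')).sub ((hcont u').mul (hden u))) (fun q hq => ?_) hp
    have hqU := good_subset U hq
    obtain ⟨ρ, hρ⟩ := h q hq
    obtain ⟨τ, hτ⟩ := hρ u
    obtain ⟨τ', hτ'⟩ := hρ u'
    have hy : 0 < fundInner F q.1 q.2 q.2 q.2 := hF.fundInner_pos hqU (hF.ne_zero _ _ hqU)
    have h1 := hF.flag_numerator_eq hqU hτ
    have h2 := hF.flag_numerator_eq hqU hτ'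
    apply mul_left_cancel₀ hy.ne'
    simp only [mul_zero, Pi.sub_apply, Pi.mul_apply]
    linear_combination (fundInner F q.1 q.2 q.2 q.2 *
        fundInner F q.1 q.2 u' u' - fundInner F q.1 q.2 q.2 u' ^ 2) * h1 -
      (fundInner F q.1 q.2 q.2 q.2 *
        fundInner F q.1 q.2 u u - fundInner F q.1 q.2 q.2 u ^ 2) * h2
  -- All planes at a pair give the same value, so K may be read off from any chosen u.
  classical
  refine ⟨fun x y => if hu : ∃ u : E n, LinearIndependent ℝ ![y, u] then
    flagCurvature F x y hu.choose else 0, fun x y hxy u hu => ?_⟩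
  have hex : ∃ u : E n, LinearIndependent ℝ ![y, u] := ⟨u, hu⟩
  simp only [dif_pos hex]
  have d1 := hF.flag_denominator_pos hxy hu
  have d2 := hF.flag_denominator_pos hxy hex.choose_spec
  have := key (x, y) hxy u hex.choose
  unfold flagCurvature
  rw [div_eq_div_iff d1.ne' d2.ne']
  exact sub_eq_zero.1 this

/-- If the geodesic coefficients are proportional to `y` at good pairs, geodesics are straight. -/
theorem isProjectivelyFlatOn_of_good (hF : IsFinslerOn F U)
    (h : ∀ p ∈ good U, ∃ c : ℝ, sprayVec F p = c • p.2) : IsProjectivelyFlatOn F U := by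
  -- Proportionality with its factor made explicit is a closed condition and extends by continuity.
  -- In dimension at most one it is automatic.
  have hpar : ∀ p ∈ U, qb p • sprayVec F p = (inner ℝ p.2 (sprayVec F p) : ℝ) • p.2 := by
    intro p hp
    by_cases hn : 2 ≤ n
    · ext i
      have hG := contDiffOn_euclidean.1 hF.contDiffOn_sprayVec i
      have hc : ContinuousOn (fun q : E n × E n => qb q * sprayVec F q i
          - inner ℝ q.2 (sprayVec F q) * q.2 i) U :=
        ((contDiff_qb.contDiffOn.mul hG).sub
          ((contDiffOn_snd.inner ℝ hF.contDiffOn_sprayVec).mul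
            (contDiffOn_euclidean.1 contDiffOn_snd i))).continuousOn
      have := eq_zero_of_good hF.isOpen (fun p hp => hF.ne_zero _ _ hp) hn hc (fun q hq => by
        obtain ⟨c, hc⟩ := h q hq
        rw [hc, real_inner_smul_right, PiLp.smul_apply, qb, smul_eq_mul]
        ring) hp
      simpa [sub_eq_zero] using this
    · have : Subsingleton (Fin n) := Fin.subsingleton_iff_le_one.2 (by omega)
      ext i
      simp only [qb, PiLp.inner_apply, PiLp.smul_apply, smul_eq_mul, RCLike.inner_apply,
        conj_trivial]
      rw [Fintype.sum_subsingleton _ i, Fintype.sum_subsingleton _ i]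
      ring
  intro γ a b hγ
  by_cases hab : (Ioo a b).Nonempty
  swap
  · exact ⟨0, 0, fun t ht => (hab ⟨t, ht⟩).elim⟩
  obtain ⟨t₀, ht₀⟩ := hab
  -- The unit tangent is constant: γ'' is parallel to γ', so only the speed varies. Hence the part
  -- of γ orthogonal to this unit vector is constant too.
  set e : ℝ → E n := fun t => ‖deriv γ t‖⁻¹ • deriv γ t with he
  have he' : ∀ t ∈ Ioo a b, HasDerivAt e 0 t := by
    intro t ht
    obtain ⟨hU, -, h2⟩ := hγ t ht
    have hne : deriv γ t ≠ 0 := hF.ne_zero _ _ hU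
    have hn0 : ‖deriv γ t‖ ≠ 0 := norm_ne_zero_iff.2 hne
    have hG : (WithLp.toLp 2 fun i => -2 * spray F i (γ t) (deriv γ t) : E n) =
        (-2 : ℝ) • sprayVec F (γ t, deriv γ t) := by
      ext i; simp [sprayVec]
    rw [hG] at h2
    have hp := hpar _ hU
    set G := sprayVec F (γ t, deriv γ t)
    have hn1 : HasDerivAt (fun s => ‖deriv γ s‖)
        (inner ℝ (deriv γ t) ((-2 : ℝ) • G) / ‖deriv γ t‖) t := by
      have h3 := (h2.norm_sq).sqrt (by positivity)
      simp only [Real.sqrt_sq (norm_nonneg _)] at h3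
      convert h3 using 1
      field_simp
    refine ((hn1.inv hn0).smul h2).congr_deriv ?_
    have hG2 : G = (inner ℝ (deriv γ t) G / ‖deriv γ t‖ ^ 2 : ℝ) • deriv γ t := by
      have hq : qb (γ t, deriv γ t) = ‖deriv γ t‖ ^ 2 := real_inner_self_eq_norm_sq _
      rw [hq] at hp
      rw [div_eq_inv_mul, mul_smul, ← hp, smul_smul, inv_mul_cancel₀ (by positivity), one_smul]
    rw [real_inner_smul_right]
    conv_lhs => enter [1, 2]; rw [hG2]
    rw [smul_smul, smul_smul, ← add_smul]
    convert zero_smul ℝ _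
    simp only [Pi.inv_apply]
    field_simp
    ring
  have hopen : IsOpen (Ioo a b) := isOpen_Ioo
  have hpre : IsPreconnected (Ioo a b) := isPreconnected_Ioo
  have hconst : ∀ t ∈ Ioo a b, e t = e t₀ := fun t ht =>
    hopen.is_const_of_deriv_eq_zero hpre
      (fun s hs => (he' s hs).differentiableAt.differentiableWithinAt)
      (fun s hs => (he' s hs).deriv) ht ht₀
  set v := e t₀ with hv
  have hvn : inner ℝ v v = (1 : ℝ) := by
    have hne : deriv γ t₀ ≠ 0 := hF.ne_zero _ _ (hγ t₀ ht₀).1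
    rw [hv, he, real_inner_self_eq_norm_sq, norm_smul, norm_inv, norm_norm,
      inv_mul_cancel₀ (norm_ne_zero_iff.2 hne), one_pow]
  have hγ' : ∀ t ∈ Ioo a b, HasDerivAt (fun s => γ s - (inner ℝ v (γ s) : ℝ) • v) 0 t := by
    intro t ht
    obtain ⟨hU, h1, -⟩ := hγ t ht
    have hne : deriv γ t ≠ 0 := hF.ne_zero _ _ hU
    have hd : deriv γ t = ‖deriv γ t‖ • v := by
      rw [← hconst t ht, he, smul_smul, mul_inv_cancel₀ (norm_ne_zero_iff.2 hne), one_smul]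
    have h2 := h1.hasDerivAt
    refine (h2.sub (((hasDerivAt_const t v).inner ℝ h2).smul_const v)).congr_deriv ?_
    rw [hd, real_inner_smul_right, hvn]
    simp
  refine ⟨γ t₀ - (inner ℝ v (γ t₀) : ℝ) • v, v, fun t ht => ⟨inner ℝ v (γ t), ?_⟩⟩
  have := hopen.is_const_of_deriv_eq_zero hpre
      (fun s hs => (hγ' s hs).differentiableAt.differentiableWithinAt)
      (fun s hs => (hγ' s hs).deriv) ht ht₀
  rw [← this]
  simp

end IsFinslerOn

/-! ### Derivatives of the invariants -/

theorem diffAt_qa (p : E n × E n) : DifferentiableAt ℝ qa p :=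
  contDiff_qa.differentiable (by simp) p
theorem diffAt_qv (p : E n × E n) : DifferentiableAt ℝ qv p :=
  contDiff_qv.differentiable (by simp) p
theorem diffAt_qb (p : E n × E n) : DifferentiableAt ℝ qb p :=
  contDiff_qb.differentiable (by simp) p

theorem D_qv (w p : E n × E n) : D w qv p = inner ℝ w.1 p.2 + inner ℝ p.1 w.2 := by
  have := (hasFDerivAt_fst (𝕜 := ℝ) (p := p)).inner ℝ (hasFDerivAt_snd (𝕜 := ℝ) (p := p))
  unfold D
  erw [this.fderiv]
  simp [fderivInnerCLM_apply, add_comm]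

theorem D_qa (w p : E n × E n) : D w qa p = 2 * inner ℝ p.1 w.1 := by
  have := (hasFDerivAt_fst (𝕜 := ℝ) (p := p)).inner ℝ (hasFDerivAt_fst (𝕜 := ℝ) (p := p))
  unfold D
  erw [this.fderiv]
  simp [fderivInnerCLM_apply, real_inner_comm w.1 p.1, two_mul]

theorem D_qb (w p : E n × E n) : D w qb p = 2 * inner ℝ p.2 w.2 := by
  have := (hasFDerivAt_snd (𝕜 := ℝ) (p := p)).inner ℝ (hasFDerivAt_snd (𝕜 := ℝ) (p := p))
  unfold D
  erw [this.fderiv]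
  simp [fderivInnerCLM_apply, real_inner_comm w.2 p.2, two_mul]

theorem D_gram (w p : E n × E n) :
    D w gram p = D w qa p * qb p + qa p * D w qb p - 2 * qv p * D w qv p := by
  change D w (fun q => qa q * qb q - qv q ^ 2) p = _
  rw [D_sub ((diffAt_qa p).fun_mul (diffAt_qb p)) ((diffAt_qv p).fun_pow 2),
    D_mul (diffAt_qa p) (diffAt_qb p), D_sq (diffAt_qv p)]
  ring

/-- The set of pairs of linearly independent vectors. -/
def indep (n : ℕ) : Set (E n × E n) := {p | 0 < gram p}

theorem isOpen_indep : IsOpen (indep n) := isOpen_lt continuous_const contDiff_gram.continuous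

theorem good_subset_indep (U : Set (E n × E n)) : good U ⊆ indep n := fun _ h => h.2.2

theorem qA_pos {p : E n × E n} (hp : p ∈ indep n) : 0 < qA p := Real.sqrt_pos.2 hp

theorem qA_sq {p : E n × E n} (hp : p ∈ indep n) : qA p ^ 2 = gram p := Real.sq_sqrt (le_of_lt hp)

theorem qa_pos {p : E n × E n} (hp : p ∈ indep n) : 0 < qa p := by
  have ha : 0 ≤ qa p := real_inner_self_nonneg
  rcases ha.eq_or_lt with h | h
  · have : 0 < gram p := hp
    rw [gram, ← h] at this
    nlinarith [sq_nonneg (qv p)]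
  · exact h

theorem qb_eq {p : E n × E n} (hp : p ∈ indep n) : qb p = (qA p ^ 2 + qv p ^ 2) / qa p := by
  rw [qA_sq hp, gram]
  field_simp [(qa_pos hp).ne']
  ring

theorem contDiffOn_qA : ContDiffOn ℝ ∞ (qA (n := n)) (indep n) :=
  contDiff_gram.contDiffOn.sqrt fun _ hp => ne_of_gt hp

theorem diffAt_qA {p : E n × E n} (hp : p ∈ indep n) : DifferentiableAt ℝ qA p :=
  ContDiffOn.diffAt isOpen_indep contDiffOn_qA hp

theorem D_qA (w : E n × E n) {p : E n × E n} (hp : p ∈ indep n) :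
    D w qA p = (D w qa p * qb p + qa p * D w qb p - 2 * qv p * D w qv p) / (2 * qA p) := by
  have h1 : D w (fun q => qA q ^ 2) p = D w gram p :=
    D_congr isOpen_indep (fun q hq => qA_sq hq) w hp
  rw [D_sq (diffAt_qA hp), D_gram] at h1
  rw [← h1]
  field_simp [(qA_pos hp).ne']

/-! ### The coefficient T of x in the spray -/

section Coefficient

/-- The coefficient of `x` in the geodesic coefficients. -/
def coefT (k : ℝ) (p : E n × E n) : ℝ :=
  (2 * k * qv p * qA p - k ^ 2 * qv p ^ 2) / (2 * qa p ^ 2)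

/-- The derivative of `coefT` in the direction `(0, u)`. -/
def coefTu (k : ℝ) (u : E n) (p : E n × E n) : ℝ :=
  (k * qA p * inner ℝ p.1 u - k ^ 2 * qv p * inner ℝ p.1 u +
    k * qv p * (qa p * inner ℝ p.2 u - qv p * inner ℝ p.1 u) / qA p) / qa p ^ 2

variable (k : ℝ)

theorem contDiffOn_coefT : ContDiffOn ℝ ∞ (coefT (n := n) k) (indep n) := by
  have hv := contDiff_qv (n := n).contDiffOn (s := indep n)
  have ha := contDiff_qa (n := n).contDiffOn (s := indep n)
  exact (((contDiffOn_const.mul hv).mul contDiffOn_qA).sub (contDiffOn_const.mul (hv.pow 2))).div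
    (contDiffOn_const.mul (ha.pow 2))
    (fun p hp => by have := qa_pos hp; positivity)

variable {k} {p : E n × E n} (u : E n)

theorem line_qA (hp : p ∈ indep n) (w : E n × E n) :
    HasDerivAt (fun t : ℝ => qA (p + t • w)) (D w qA p) 0 := hasDerivAt_line (diffAt_qA hp) w

theorem line_inner_fst (p w : E n × E n) (u : E n) :
    HasDerivAt (fun t : ℝ => (inner ℝ (p + t • w).1 u : ℝ)) (inner ℝ w.1 u) 0 := by
  have := ((hasDerivAt_id (0 : ℝ)).mul_const (inner ℝ w.1 u : ℝ)).const_add (inner ℝ p.1 u : ℝ)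
  simpa [inner_add_left, real_inner_smul_left] using this

theorem line_inner_snd (p w : E n × E n) (u : E n) :
    HasDerivAt (fun t : ℝ => (inner ℝ (p + t • w).2 u : ℝ)) (inner ℝ w.2 u) 0 := by
  have := ((hasDerivAt_id (0 : ℝ)).mul_const (inner ℝ w.2 u : ℝ)).const_add (inner ℝ p.2 u : ℝ)
  simpa [inner_add_left, real_inner_smul_left] using this

theorem D_coefT (hp : p ∈ indep n) (w : E n × E n) : D w (coefT k) p =
    (2 * k * (D w qv p * qA p + qv p * D w qA p) - 2 * k ^ 2 * qv p * D w qv p) / (2 * qa p ^ 2)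
      - 2 * coefT k p * D w qa p / qa p := by
  have ha := qa_pos hp
  have hv := hasDerivAt_line (diffAt_qv p) w
  have hA := line_qA hp w
  have ha' := hasDerivAt_line (diffAt_qa p) w
  have h := (((hv.const_mul (2 * k)).mul hA).sub ((hv.pow 2).const_mul (k ^ 2))).div
    ((ha'.pow 2).const_mul 2) (by simp only [zero_smul, add_zero, Pi.pow_apply]; positivity)
  refine D_eq_of_line (ContDiffOn.diffAt isOpen_indep (contDiffOn_coefT k) hp)
    (h.congr_deriv ?_)
  simp only [zero_smul, add_zero, coefT, Pi.pow_apply, Pi.mul_apply, Pi.sub_apply]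
  field_simp
  ring

theorem D_snd_coefT (hp : p ∈ indep n) (u : E n) : D (0, u) (coefT k) p = coefTu k u p := by
  have ha := qa_pos hp
  have hA := qA_pos hp
  rw [D_coefT hp, D_qA _ hp, D_qv, D_qa, D_qb, coefTu, inner_zero_left, inner_zero_right]
  field_simp
  ring

theorem contDiffOn_coefTu : ContDiffOn ℝ ∞ (coefTu (n := n) k u) (indep n) :=
  (contDiffOn_D isOpen_indep (contDiffOn_coefT k) (0, u)).congr
    fun _ hp => (D_snd_coefT hp u).symm

theorem D_coefTu (hp : p ∈ indep n) (w : E n × E n) (u : E n) : D w (coefTu k u) p =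
    (k * D w qA p * inner ℝ p.1 u + k * qA p * inner ℝ w.1 u - k ^ 2 * D w qv p * inner ℝ p.1 u
      - k ^ 2 * qv p * inner ℝ w.1 u
      + k * D w qv p * (qa p * inner ℝ p.2 u - qv p * inner ℝ p.1 u) / qA p
      + k * qv p * (D w qa p * inner ℝ p.2 u + qa p * inner ℝ w.2 u - D w qv p * inner ℝ p.1 u
        - qv p * inner ℝ w.1 u) / qA p
      - k * qv p * (qa p * inner ℝ p.2 u - qv p * inner ℝ p.1 u) * D w qA p / qA p ^ 2) / qa p ^ 2
      - 2 * coefTu k u p * D w qa p / qa p := by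
  have ha := qa_pos hp
  have hApos := qA_pos hp
  have hv := hasDerivAt_line (diffAt_qv p) w
  have hA := line_qA hp w
  have ha' := hasDerivAt_line (diffAt_qa p) w
  have hx := line_inner_fst p w u
  have hy := line_inner_snd p w u
  have h := (((((hA.const_mul k).mul hx).sub ((hv.const_mul (k ^ 2)).mul hx))).add
    (((hv.const_mul k).mul ((ha'.mul hy).sub (hv.mul hx))).div hA
      (by simp only [zero_smul, add_zero]; positivity))).div
    (ha'.pow 2) (by simp only [zero_smul, add_zero, Pi.pow_apply]; positivity)
  refine D_eq_of_line (ContDiffOn.diffAt isOpen_indep (contDiffOn_coefTu u) hp)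
    (h.congr_deriv ?_)
  simp only [zero_smul, add_zero, coefTu, Pi.pow_apply, Pi.mul_apply, Pi.sub_apply, Pi.add_apply,
    Pi.div_apply]
  field_simp
  ring

theorem D_D_coefT (hp : p ∈ indep n) (w : E n × E n) (u : E n) :
    D w (D (0, u) (coefT k)) p = D w (coefTu k u) p :=
  D_congr isOpen_indep (fun _ hq => D_snd_coefT hq u) w hp

theorem D_euler_coefT (hp : p ∈ indep n) : D (0, p.2) (coefT k) p = 2 * coefT k p := by
  have ha := qa_pos hp
  have hA := qA_pos hp
  have e1 : (inner ℝ p.1 p.2 : ℝ) = qv p := rfl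
  have e2 : (inner ℝ p.2 p.2 : ℝ) = qb p := rfl
  rw [D_snd_coefT hp, coefTu, coefT, e1, e2, qb_eq hp]
  field_simp
  ring

theorem D_radial_coefT (hp : p ∈ indep n) :
    D (0, p.1) (coefT k) p = (k * qA p - k ^ 2 * qv p) / qa p := by
  have ha := qa_pos hp
  have hA := qA_pos hp
  have e1 : (inner ℝ p.2 p.1 : ℝ) = qv p := real_inner_comm _ _
  have e2 : (inner ℝ p.1 p.1 : ℝ) = qa p := rfl
  rw [D_snd_coefT hp, coefTu, e1, e2]
  field_simp
  ring

/-- The trace free part of the curvature of the spray with coefficients `coefT k • x` vanishes. -/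
theorem coefT_curvature (hp : p ∈ indep n) (u : E n) :
    2 * D (u, 0) (coefT k) p - D (p.2, 0) (D (0, u) (coefT k)) p
      + 2 * coefT k p * D (0, p.1) (D (0, u) (coefT k)) p
      - D (0, p.1) (coefT k) p * D (0, u) (coefT k) p = 0 := by
  have ha := qa_pos hp
  have hA := qA_pos hp
  have e1 : (inner ℝ p.1 p.2 : ℝ) = qv p := rfl
  have e1' : (inner ℝ p.2 p.1 : ℝ) = qv p := real_inner_comm _ _
  have e2 : (inner ℝ p.2 p.2 : ℝ) = qb p := rfl
  have e3 : (inner ℝ p.1 p.1 : ℝ) = qa p := rfl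
  have e4 : (inner ℝ u p.2 : ℝ) = inner ℝ p.2 u := real_inner_comm _ _
  -- Once b is replaced by (A² + v²)/a, the claim is a rational identity in a, v, A, ⟨x,u⟩, ⟨y,u⟩
  -- and k.
  rw [D_D_coefT hp, D_D_coefT hp, D_radial_coefT hp, D_snd_coefT hp, D_coefT hp, D_coefTu hp,
    D_coefTu hp]
  simp only [D_qA _ hp, D_qv, D_qa, D_qb, inner_zero_left, inner_zero_right, e1, e1', e2, e3, e4,
    coefTu, coefT, qb_eq hp]
  field_simp
  ring

end Coefficient

/-! ### Curvature of a spray T x + P y -/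

section Curvature

variable {O : Set (E n × E n)}

theorem D_combination {T P : E n × E n → ℝ} {p : E n × E n} (hT : DifferentiableAt ℝ T p)
    (hP : DifferentiableAt ℝ P p) (w : E n × E n) :
    D w (fun q => T q • q.1 + P q • q.2) p =
      T p • w.1 + D w T p • p.1 + (P p • w.2 + D w P p • p.2) := by
  have h1 : D w (fun q : E n × E n => q.1) p = w.1 :=
    D_clm (ContinuousLinearMap.fst ℝ (E n) (E n)) w p
  have h2 : D w (fun q : E n × E n => q.2) p = w.2 :=
    D_clm (ContinuousLinearMap.snd ℝ (E n) (E n)) w p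
  rw [D_add (hT.fun_smul differentiableAt_fst) (hP.fun_smul differentiableAt_snd),
    D_smul hT differentiableAt_fst, D_smul hP differentiableAt_snd, h1, h2]

/-- In the coefficient of x in R(u), the terms containing P cancel because T is homogeneous of
degree two in y. What remains is the expression in T that `hcurv` sets to zero. -/
theorem riemannVec_eq_of_eqOn {F : E n → E n → ℝ} (hO : IsOpen O) {T P : E n × E n → ℝ}
    (hT : ContDiffOn ℝ ∞ T O) (hP : ContDiffOn ℝ ∞ P O)
    (hG : EqOn (sprayVec F) (fun p => T p • p.1 + P p • p.2) O)
    (hT2 : ∀ p ∈ O, D (0, p.2) T p = 2 * T p)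
    (hcurv : ∀ p ∈ O, ∀ u, 2 * D (u, 0) T p - D (p.2, 0) (D (0, u) T) p
      + 2 * T p * D (0, p.1) (D (0, u) T) p - D (0, p.1) T p * D (0, u) T p = 0)
    {p : E n × E n} (hp : p ∈ O) :
    ∃ ρ : ℝ, ∀ u, ∃ τ : ℝ, riemannVec F p u = ρ • u + τ • p.2 := by
  have dT : ∀ q ∈ O, DifferentiableAt ℝ T q := fun q hq => ContDiffOn.diffAt hO hT hq
  have dP : ∀ q ∈ O, DifferentiableAt ℝ P q := fun q hq => ContDiffOn.diffAt hO hP hq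
  have hDG : ∀ w, EqOn (D w (sprayVec F))
      (fun q => T q • w.1 + D w T q • q.1 + (P q • w.2 + D w P q • q.2)) O := fun w q hq => by
    rw [D_congr hO hG w hq]
    exact D_combination (dT q hq) (dP q hq) w
  have hDDG : ∀ u w, D w (D (0, u) (sprayVec F)) p =
      (D (0, u) T p • w.1 + D w (D (0, u) T) p • p.1
        + (D (0, u) P p • w.2 + D w (D (0, u) P) p • p.2)) + D w P p • u := fun u w => by
    have d1 := ContDiffOn.diffAt hO (contDiffOn_D hO hT (0, u)) hp
    have d2 := ContDiffOn.diffAt hO (contDiffOn_D hO hP (0, u)) hp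
    have h1 : EqOn (D (0, u) (sprayVec F))
        (fun q => (D (0, u) T q • q.1 + D (0, u) P q • q.2) + P q • u) O := fun q hq => by
      rw [hDG (0, u) hq]
      simp only [smul_zero, zero_add]
      abel
    rw [D_congr hO h1 w hp, D_add ((d1.fun_smul differentiableAt_fst).fun_add
      (d2.fun_smul differentiableAt_snd)) ((dP p hp).smul_const u), D_combination d1 d2,
      D_smul (dP p hp) (differentiableAt_const u), D_const, smul_zero, zero_add]
  refine ⟨2 * T p - D (sprayField F p) P p - P p ^ 2, fun u => ?_⟩
  have hS : sprayField F p = (p.2, 0) + (-2 * T p) • ((0 : E n), p.1)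
      + (-2 * P p) • ((0 : E n), p.2) := by
    rw [sprayField, hG hp]
    ext i <;> simp
    ring
  -- Both assumptions on T enter here: D_{(0,u)}T has degree one in y, and `hcurv` removes the
  -- remaining second derivatives.
  have hST : D (sprayField F p) (D (0, u) T) p = 2 * D (u, 0) T p
      - D (0, p.1) T p * D (0, u) T p - 2 * P p * D (0, u) T p := by
    have h1 := D_euler_D hO hT 2 hT2 hp (0, u)
    have h2 := hcurv p hp u
    rw [hS, D_add_dir, D_add_dir, D_smul_dir, D_smul_dir, h1]
    simp only [smul_eq_mul]
    linarith
  have hN : ∀ f : E n × E n → ℝ, D (0, D (0, u) (sprayVec F) p) f p =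
      D (0, u) T p * D (0, p.1) f p + P p * D (0, u) f p + D (0, u) P p * D (0, p.2) f p := by
    intro f
    have : ((0 : E n), D (0, u) (sprayVec F) p) = D (0, u) T p • ((0 : E n), p.1)
        + P p • ((0 : E n), u) + D (0, u) P p • ((0 : E n), p.2) := by
      rw [hDG (0, u) hp]
      ext i <;> simp
      ring
    rw [this, D_add_dir, D_add_dir, D_smul_dir, D_smul_dir, D_smul_dir]
    simp only [smul_eq_mul]
  refine ⟨2 * D (u, 0) P p - D (0, u) T p + 2 * D (0, u) P p * P p
    - D (sprayField F p) (D (0, u) P) p - P p * D (0, u) P p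
    - (D (0, u) T p * D (0, p.1) P p + P p * D (0, u) P p + D (0, u) P p * D (0, p.2) P p), ?_⟩
  rw [riemannVec, hDDG, hDG (u, 0) hp]
  rw [hDG (0, D (0, u) (sprayVec F) p) hp]
  simp only [hN, hST, hT2 p hp]
  rw [hDG (0, u) hp]
  simp only [sprayField]
  rw [hG hp]
  simp only [smul_zero, zero_add]
  module

end Curvature

/-! ### Rapcsák's criterion -/

namespace IsFinslerOn

variable {F : E n → E n → ℝ} {U : Set (E n × E n)}

/-- The coefficient of `y` in the geodesic coefficients of a metric projectively related to the
spray `T • x`. -/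
def projFactor (F : E n → E n → ℝ) (T : E n × E n → ℝ) (p : E n × E n) : ℝ :=
  ((1 / 2) * D (p.2, 0) (unc F) p - T p * D (0, p.1) (unc F) p) / unc F p

/-- Expand the second derivatives of F² into derivatives of F. Rapcsák's equation takes care of the
terms with second derivatives, and the definition of P matches the terms along the y-gradient of F.
-/
theorem sprayVec_eq_of_rapcsak (hF : IsFinslerOn F U) {p : E n × E n} (hp : p ∈ U)
    {T : E n × E n → ℝ}
    (h : ∀ u, D (p.2, 0) (D (0, u) (unc F)) p - D (u, 0) (unc F) p =
      2 * T p * D (0, p.1) (D (0, u) (unc F)) p) :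
    sprayVec F p = T p • p.1 + projFactor F T p • p.2 := by
  have hU := hF.isOpen
  have hf := hF.contDiffOn_unc
  have hFp : unc F p ≠ 0 := (hF.pos _ _ hp).ne'
  have e1 : ∀ w, EqOn (D w (en F)) (fun q => 2 * unc F q * D w (unc F) q) U := fun w q hq =>
    D_sq (ContDiffOn.diffAt hU hf hq) w
  have e2 : ∀ w u, D w (D u (en F)) p =
      2 * unc F p * D w (D u (unc F)) p + 2 * D w (unc F) p * D u (unc F) p := fun w u => by
    have d1 := ContDiffOn.diffAt hU hf hp
    rw [D_congr hU (e1 u) w hp, D_mul (d1.const_mul 2)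
      (ContDiffOn.diffAt hU (contDiffOn_D hU hf u) hp), D_const_mul d1]
  refine hF.sprayVec_unique hp fun u => ?_
  have e3 : ((0 : E n), T p • p.1 + projFactor F T p • p.2) =
    T p • (0, p.1) + projFactor F T p • (0, p.2) := by simp
  have e4 : projFactor F T p * unc F p =
      (1 / 2) * D (p.2, 0) (unc F) p - T p * D (0, p.1) (unc F) p := by
    rw [projFactor]; field_simp
  rw [hF.fundInner_eq hp, e3, D_add_dir, D_smul_dir, D_smul_dir, e2, e2, e2, e1 _ hp,
    hF.D_euler_D_unc hp, hF.D_euler_unc hp, smul_eq_mul, smul_eq_mul]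
  linear_combination (D (0, u) (unc F) p) * e4 - (1 / 2) * unc F p * h u

theorem contDiffOn_projFactor (hF : IsFinslerOn F U) {T : E n × E n → ℝ} {O : Set (E n × E n)}
    (hOU : O ⊆ U) (hT : ContDiffOn ℝ ∞ T O) : ContDiffOn ℝ ∞ (projFactor F T) O := by
  have hf := hF.contDiffOn_unc
  have h1 : ContDiffOn ℝ ∞ (fun p : E n × E n => (p.2, (0 : E n))) U :=
    contDiffOn_snd.prodMk contDiffOn_const
  have h2 : ContDiffOn ℝ ∞ (fun p : E n × E n => ((0 : E n), p.1)) U :=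
    contDiffOn_const.prodMk contDiffOn_fst
  exact ((contDiffOn_const.mul ((contDiffOn_D_field hF.isOpen hf h1).mono hOU)).sub
    (hT.mul ((contDiffOn_D_field hF.isOpen hf h2).mono hOU))).div (hf.mono hOU)
    fun p hp => (hF.pos _ _ (hOU hp)).ne'

end IsFinslerOn

/-! ### Passing from (r, s) to a, v, A; the function φ̄ -/

theorem norm_sq_fst (p : E n × E n) : ‖p.1‖ ^ 2 = qa p := (real_inner_self_eq_norm_sq _).symm
theorem norm_sq_snd (p : E n × E n) : ‖p.2‖ ^ 2 = qb p := (real_inner_self_eq_norm_sq _).symm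
theorem norm_fst_eq (p : E n × E n) : ‖p.1‖ = √(qa p) := by
  rw [← norm_sq_fst, Real.sqrt_sq (norm_nonneg _)]
theorem norm_snd_eq (p : E n × E n) : ‖p.2‖ = √(qb p) := by
  rw [← norm_sq_snd, Real.sqrt_sq (norm_nonneg _)]

theorem qb_pos {p : E n × E n} (hp : p ∈ indep n) : 0 < qb p := by
  rw [qb_eq hp]
  have := qa_pos hp
  have := qA_pos hp
  positivity

theorem norm_snd_pos {p : E n × E n} (hp : p ∈ indep n) : 0 < ‖p.2‖ := by
  rw [norm_snd_eq]; exact Real.sqrt_pos.2 (qb_pos hp)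

theorem norm_fst_pos {p : E n × E n} (hp : p ∈ indep n) : 0 < ‖p.1‖ := by
  rw [norm_fst_eq]; exact Real.sqrt_pos.2 (qa_pos hp)

theorem sq_sub_sq_eq {p : E n × E n} (hp : p ∈ indep n) :
    ‖p.1‖ ^ 2 - (qv p / ‖p.2‖) ^ 2 = (qA p / ‖p.2‖) ^ 2 := by
  have hb := norm_snd_pos hp
  rw [div_pow, div_pow, qA_sq hp, gram, ← norm_sq_fst, ← norm_sq_snd]
  field_simp

theorem sqrt_sq_sub_sq {p : E n × E n} (hp : p ∈ indep n) :
    √(‖p.1‖ ^ 2 - (qv p / ‖p.2‖) ^ 2) = qA p / ‖p.2‖ := by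
  rw [sq_sub_sq_eq hp, Real.sqrt_sq]
  exact div_nonneg (qA_pos hp).le (norm_nonneg _)

theorem abs_lt_norm {p : E n × E n} (hp : p ∈ indep n) : |qv p / ‖p.2‖| < ‖p.1‖ := by
  apply abs_lt_of_sq_lt_sq _ (norm_nonneg _)
  have h := sq_sub_sq_eq hp
  have : 0 < (qA p / ‖p.2‖) ^ 2 := by
    have := qA_pos hp
    have := norm_snd_pos hp
    positivity
  linarith

theorem mem_profileDomain {U : Set (E n × E n)} {p : E n × E n} (hp : p ∈ good U) :
    (‖p.1‖, qv p / ‖p.2‖) ∈ profileDomain U :=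
  ⟨div_ne_zero hp.2.1 (norm_snd_pos hp.2.2).ne', abs_lt_norm hp.2.2, p.1, p.2, hp.1, rfl⟩

section PhiBar

/-- The quadratic form `A² - 2kvA + (1 + k²)v²`. -/
def qD (k : ℝ) (p : E n × E n) : ℝ := qA p ^ 2 - 2 * k * qv p * qA p + (1 + k ^ 2) * qv p ^ 2

theorem qD_pos (k : ℝ) {p : E n × E n} (hp : p ∈ indep n) : 0 < qD k p := by
  have hA := qA_pos hp
  have h : qD k p = (qA p - k * qv p) ^ 2 + qv p ^ 2 := by rw [qD]; ring
  rw [h]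
  by_cases hv : qv p = 0
  · rw [hv]; simp; positivity
  · positivity

/-- `phiBar` as a function of `x` and `y`. -/
def phiBarVec (k : ℝ) (p : E n × E n) : ℝ :=
  qa p ^ (k ^ 2 + 1) * qA p ^ 2 * Real.exp (2 * k * Real.arctan (k - (1 + k ^ 2) * qv p / qA p)) /
    qD k p

theorem phiBar_eq (k : ℝ) {p : E n × E n} (hp : p ∈ indep n) :
    phiBar k ‖p.1‖ (qv p / ‖p.2‖) = phiBarVec k p := by
  have hb := norm_snd_pos hp
  have hA := qA_pos hp
  have hD := qD_pos k hp
  have e1 : ‖p.1‖ ^ (2 * (k ^ 2 + 1)) = qa p ^ (k ^ 2 + 1) := by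
    rw [Real.rpow_mul (norm_nonneg _), Real.rpow_two, norm_sq_fst]
  have e2 : (1 + k ^ 2) * (qv p / ‖p.2‖) / (qA p / ‖p.2‖) = (1 + k ^ 2) * qv p / qA p := by
    field_simp
  have e3 : ‖p.1‖ ^ 2 = (qA p / ‖p.2‖) ^ 2 + (qv p / ‖p.2‖) ^ 2 := by
    linarith [sq_sub_sq_eq hp]
  have e4 : k ^ 2 * (qv p / ‖p.2‖) ^ 2 - 2 * k * (qv p / ‖p.2‖) * (qA p / ‖p.2‖) + ‖p.1‖ ^ 2 =
      qD k p / ‖p.2‖ ^ 2 := by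
    rw [e3, qD]; field_simp; ring
  rw [phiBar, sqrt_sq_sub_sq hp, e1, sq_sub_sq_eq hp, e2, e4, phiBarVec]
  field_simp

theorem contDiffOn_phiBarVec (k : ℝ) : ContDiffOn ℝ ∞ (phiBarVec (n := n) k) (indep n) := by
  have hv := contDiff_qv (n := n).contDiffOn (s := indep n)
  have ha := contDiff_qa (n := n).contDiffOn (s := indep n)
  have hA := contDiffOn_qA (n := n)
  refine ContDiffOn.div (((ha.rpow_const_of_ne fun p hp => (qa_pos hp).ne').mul (hA.pow 2)).mul
    (ContDiffOn.exp (contDiffOn_const.mul (Real.contDiff_arctan.comp_contDiffOn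
      (contDiffOn_const.sub ((contDiffOn_const.mul hv).div hA fun p hp => (qA_pos hp).ne'))))))
    (((hA.pow 2).sub ((contDiffOn_const.mul hv).mul hA)).add (contDiffOn_const.mul (hv.pow 2)))
    fun p hp => (qD_pos k hp).ne'

/-- Only directions that preserve A are needed, and for them the logarithmic derivative is short. -/
theorem D_phiBarVec (k : ℝ) {p : E n × E n} (hp : p ∈ indep n) {w : E n × E n}
    (hw : D w qA p = 0) : D w (phiBarVec k) p =
      phiBarVec k p * (k ^ 2 + 1) * (D w qa p / qa p - 2 * qv p * D w qv p / qD k p) := by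
  have ha := qa_pos hp
  have hApos := qA_pos hp
  have hD := qD_pos k hp
  have lv := hasDerivAt_line (diffAt_qv p) w
  have la := hasDerivAt_line (diffAt_qa p) w
  have lA := line_qA hp w
  rw [hw] at lA
  -- The derivative of the arctangent produces the same quadratic form as the denominator of φ̄, so
  -- the two contributions combine.
  have hz : 1 + (k - (1 + k ^ 2) * qv p / qA p) ^ 2 = (1 + k ^ 2) * qD k p / qA p ^ 2 := by
    rw [qD]; field_simp; ring
  have l1 := la.rpow_const (p := k ^ 2 + 1) (Or.inl (by simpa using ha.ne'))
  have l2 := (((((lv.const_mul (1 + k ^ 2)).div lA (by simpa using hApos.ne')).const_sub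
    k).arctan).const_mul (2 * k)).exp
  have l3 := ((lA.pow 2).sub ((lv.const_mul (2 * k)).mul lA)).add
    ((lv.pow 2).const_mul (1 + k ^ 2))
  have l := ((l1.mul (lA.pow 2)).mul l2).div l3 (by
    simp only [zero_smul, add_zero, Pi.pow_apply, Pi.mul_apply, Pi.sub_apply, Pi.add_apply]
    exact hD.ne')
  refine D_eq_of_line (ContDiffOn.diffAt isOpen_indep (contDiffOn_phiBarVec k) hp)
    (l.congr_deriv ?_)
  simp only [zero_smul, add_zero, Pi.pow_apply, Pi.mul_apply, Pi.sub_apply, Pi.add_apply,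
    Pi.div_apply, phiBarVec]
  have e5 : qa p ^ (k ^ 2 + 1 - 1) = qa p ^ (k ^ 2 + 1) / qa p := by
    rw [Real.rpow_sub_one ha.ne']
  rw [hz, e5]
  set X := Real.exp (2 * k * Real.arctan (k - (1 + k ^ 2) * qv p / qA p))
  have hX : 0 < X := Real.exp_pos _
  set R := qa p ^ (k ^ 2 + 1)
  have hD' : qA p ^ 2 - 2 * k * qv p * qA p + (1 + k ^ 2) * qv p ^ 2 = qD k p := rfl
  rw [hD']
  field_simp
  rw [qD]
  ring

end PhiBar

theorem D_qA_left {p : E n × E n} (hp : p ∈ indep n) : D (p.2, 0) qA p = 0 := by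
  rw [D_qA _ hp, D_qv, D_qa, D_qb]
  simp only [inner_zero_right, add_zero, mul_zero]
  rw [show (inner ℝ p.1 p.2 : ℝ) = qv p from rfl, show (inner ℝ p.2 p.2 : ℝ) = qb p from rfl]
  ring

theorem D_qA_right {p : E n × E n} (hp : p ∈ indep n) : D (0, p.1) qA p = 0 := by
  rw [D_qA _ hp, D_qv, D_qa, D_qb]
  simp only [inner_zero_left, inner_zero_right, zero_add, mul_zero, zero_mul]
  rw [show (inner ℝ p.2 p.1 : ℝ) = qv p from real_inner_comm _ _,
    show (inner ℝ p.1 p.1 : ℝ) = qa p from rfl]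
  ring

/-- `phiBar` satisfies the first order equation that determines the geodesic coefficients. -/
theorem D_phiBarVec_transport (k : ℝ) {p : E n × E n} (hp : p ∈ indep n) :
    D (p.2, 0) (phiBarVec k) p = 2 * coefT k p * D (0, p.1) (phiBarVec k) p := by
  have ha := qa_pos hp
  have hD := qD_pos k hp
  -- Along (y,0) the derivatives of a and v are 2v and b; along (0,x) they are 0 and a. The claim
  -- follows from 2a²T = ab - `qD`, which is where the formula for T comes from.
  rw [D_phiBarVec k hp (D_qA_left hp), D_phiBarVec k hp (D_qA_right hp), D_qv, D_qa, D_qv, D_qa]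
  simp only [inner_zero_left, inner_zero_right, zero_add, add_zero, mul_zero, zero_div]
  rw [show (inner ℝ p.1 p.2 : ℝ) = qv p from rfl, show (inner ℝ p.2 p.2 : ℝ) = qb p from rfl,
    show (inner ℝ p.1 p.1 : ℝ) = qa p from rfl, qb_eq hp, coefT]
  field_simp
  rw [qD]
  ring

/-! ### Infinitesimal rotation invariance -/

section Rotation

theorem inner_rotation {e f : E n} (he : inner ℝ e e = (1 : ℝ)) (hf : inner ℝ f f = (1 : ℝ))
    (hef : inner ℝ e f = (0 : ℝ)) {c s : ℝ} (hcs : c ^ 2 + s ^ 2 = 1) (z w : E n) :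
    inner ℝ (z + (((c - 1) * inner ℝ z e - s * inner ℝ z f) • e
        + ((c - 1) * inner ℝ z f + s * inner ℝ z e) • f))
      (w + (((c - 1) * inner ℝ w e - s * inner ℝ w f) • e
        + ((c - 1) * inner ℝ w f + s * inner ℝ w e) • f)) = (inner ℝ z w : ℝ) := by
  have h1 : (inner ℝ e w : ℝ) = inner ℝ w e := real_inner_comm _ _
  have h2 : (inner ℝ f w : ℝ) = inner ℝ w f := real_inner_comm _ _
  have h5 : (inner ℝ f e : ℝ) = 0 := by rw [real_inner_comm]; exact hef
  simp only [inner_add_left, inner_add_right, real_inner_smul_left, real_inner_smul_right, he, hf,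
    hef, h1, h2, h5]
  linear_combination (inner ℝ z e * inner ℝ w e + inner ℝ z f * inner ℝ w f) * hcs

variable {φ : ℝ → ℝ → ℝ} {F : E n → E n → ℝ} {U : Set (E n × E n)}

/-- Rotating x and y together in the plane of e and f preserves |x|, |y| and ⟨x,y⟩, hence F.
Differentiate at angle zero; nearby pairs stay in the open set U. -/
theorem D_rotation_orthonormal (hF : IsFinslerOn F U) (hS : IsSphericallySymmetricOn φ F U)
    {p : E n × E n} (hp : p ∈ U) {e f : E n} (he : inner ℝ e e = (1 : ℝ))
    (hf : inner ℝ f f = (1 : ℝ)) (hef : inner ℝ e f = (0 : ℝ)) :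
    D ((-inner ℝ p.1 f : ℝ) • e + (inner ℝ p.1 e : ℝ) • f,
      (-inner ℝ p.2 f : ℝ) • e + (inner ℝ p.2 e : ℝ) • f) (unc F) p = 0 := by
  set R : ℝ → E n → E n := fun t z =>
    z + (((Real.cos t - 1) * inner ℝ z e - Real.sin t * inner ℝ z f) • e
        + ((Real.cos t - 1) * inner ℝ z f + Real.sin t * inner ℝ z e) • f) with hR
  have hR0 : ∀ z, R 0 z = z := fun z => by simp [hR]
  have hR' : ∀ z, HasDerivAt (fun t => R t z)
      ((-inner ℝ z f : ℝ) • e + (inner ℝ z e : ℝ) • f) 0 := fun z => by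
    have hc := (Real.hasDerivAt_cos 0).sub_const 1
    have hs := Real.hasDerivAt_sin 0
    refine ((((hc.mul_const (inner ℝ z e : ℝ)).sub (hs.mul_const (inner ℝ z f : ℝ))).smul_const
      e).add (((hc.mul_const (inner ℝ z f : ℝ)).add (hs.mul_const (inner ℝ z e : ℝ))).smul_const
      f)).const_add z |>.congr_deriv ?_
    simp
  have hγ : HasDerivAt (fun t => (R t p.1, R t p.2)) ((-inner ℝ p.1 f : ℝ) • e
      + (inner ℝ p.1 e : ℝ) • f, (-inner ℝ p.2 f : ℝ) • e + (inner ℝ p.2 e : ℝ) • f) 0 :=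
    (hR' p.1).prodMk (hR' p.2)
  have hγ0 : (R 0 p.1, R 0 p.2) = p := by simp [hR0]
  have hinner : ∀ t z w, inner ℝ (R t z) (R t w) = (inner ℝ z w : ℝ) := fun t z w =>
    inner_rotation he hf hef (by rw [Real.cos_sq_add_sin_sq]) z w
  have hnorm : ∀ t z, ‖R t z‖ = ‖z‖ := fun t z => by
    rw [← sq_eq_sq₀ (norm_nonneg _) (norm_nonneg _), ← real_inner_self_eq_norm_sq,
      ← real_inner_self_eq_norm_sq, hinner]
  have hmem : ∀ᶠ t in 𝓝 (0 : ℝ), (R t p.1, R t p.2) ∈ U :=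
    hγ.continuousAt.eventually_mem (by rw [hγ0]; exact hF.isOpen.mem_nhds hp)
  have hconst : HasDerivAt (fun t => unc F (R t p.1, R t p.2)) 0 0 := by
    refine (hasDerivAt_const (0 : ℝ) (unc F p)).congr_of_eventuallyEq ?_
    filter_upwards [hmem] with t ht
    change F _ _ = F _ _
    rw [hS _ _ ht, hS _ _ hp, hnorm, hnorm, hinner]
  have := D_eq_of_curve (f := unc F) (γ := fun t => (R t p.1, R t p.2)) (t := 0)
    (by rw [hγ0]; exact ContDiffOn.diffAt hF.isOpen hF.contDiffOn_unc hp) hγ hconst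
  rwa [hγ0] at this

/-- Infinitesimal rotation invariance. -/
theorem D_rotation (hF : IsFinslerOn F U) (hS : IsSphericallySymmetricOn φ F U)
    {p : E n × E n} (hp : p ∈ U) (hx : p.1 ≠ 0) {u : E n} (hu : inner ℝ p.1 u = (0 : ℝ)) :
    qa p * D (u, 0) (unc F) p =
      -qv p * D (0, u) (unc F) p + inner ℝ p.2 u * D (0, p.1) (unc F) p := by
  by_cases hu0 : u = 0
  · subst hu0
    rw [show ((0 : E n), (0 : E n)) = 0 from rfl, D_zero_dir, inner_zero_right]
    ring
  have hx' : ‖p.1‖ ≠ 0 := norm_ne_zero_iff.2 hx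
  have hu' : ‖u‖ ≠ 0 := norm_ne_zero_iff.2 hu0
  have h := D_rotation_orthonormal hF hS hp (e := ‖p.1‖⁻¹ • p.1) (f := ‖u‖⁻¹ • u)
    (by rw [real_inner_smul_left, real_inner_smul_right, real_inner_self_eq_norm_sq]; field_simp)
    (by rw [real_inner_smul_left, real_inner_smul_right, real_inner_self_eq_norm_sq]; field_simp)
    (by rw [real_inner_smul_left, real_inner_smul_right, hu]; simp)
  have e1 : (((-inner ℝ p.1 (‖u‖⁻¹ • u) : ℝ) • (‖p.1‖⁻¹ • p.1) +
        (inner ℝ p.1 (‖p.1‖⁻¹ • p.1) : ℝ) • (‖u‖⁻¹ • u),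
      (-inner ℝ p.2 (‖u‖⁻¹ • u) : ℝ) • (‖p.1‖⁻¹ • p.1) +
        (inner ℝ p.2 (‖p.1‖⁻¹ • p.1) : ℝ) • (‖u‖⁻¹ • u)) : E n × E n) =
      (‖p.1‖⁻¹ * ‖u‖⁻¹) • (qa p • (u, 0) + qv p • (0, u)
        + (-inner ℝ p.2 u : ℝ) • (0, p.1)) := by
    have h1 : (inner ℝ p.1 p.1 : ℝ) = qa p := rfl
    have h2 : (inner ℝ p.2 p.1 : ℝ) = qv p := real_inner_comm _ _
    simp only [real_inner_smul_right, hu, h1, h2]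
    apply Prod.ext
    · simp only [Prod.smul_fst, Prod.fst_add, smul_zero, add_zero, mul_zero, neg_zero, zero_smul,
        zero_add]
      module
    · simp only [Prod.smul_snd, Prod.snd_add, smul_zero, zero_add]
      module
  rw [e1, D_smul_dir, D_add_dir, D_add_dir, D_smul_dir, D_smul_dir, D_smul_dir] at h
  simp only [smul_eq_mul] at h
  have h3 := (mul_eq_zero.1 h).resolve_left (by positivity)
  linarith

end Rotation

/-! ### Rapcsák's equation from the integral formula -/

section Profile

theorem unc_eq {φ : ℝ → ℝ → ℝ} {F : E n → E n → ℝ} {U : Set (E n × E n)}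
    (hS : IsSphericallySymmetricOn φ F U) {p : E n × E n} (hp : p ∈ U) :
    unc F p = ‖p.2‖ * φ ‖p.1‖ (qv p / ‖p.2‖) := hS p.1 p.2 hp

variable {k : ℝ} {h η : ℝ → ℝ} {φ : ℝ → ℝ → ℝ} {F : E n → E n → ℝ} {U : Set (E n × E n)}

/-- The factor `η(phiBar) / A` of `y` in the derivative of `F`. -/
def profileFactor (k : ℝ) (η : ℝ → ℝ) (p : E n × E n) : ℝ := η (phiBarVec k p) / qA p

theorem differentiableAt_eta (hP : HasProfileOn k h η φ (profileDomain U)) {p : E n × E n}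
    (hp : p ∈ good U) : DifferentiableAt ℝ η (phiBarVec k p) := by
  obtain ⟨I, hI⟩ := hP
  have := (hI _ _ (mem_profileDomain hp)).2.1
  rwa [phiBar_eq k hp.2.2] at this

theorem differentiableAt_profileFactor (hP : HasProfileOn k h η φ (profileDomain U))
    {p : E n × E n} (hp : p ∈ good U) : DifferentiableAt ℝ (profileFactor k η) p := by
  have h1 : DifferentiableAt ℝ (fun q : E n × E n => η (phiBarVec k q)) p :=
    (differentiableAt_eta hP hp).comp p
      (ContDiffOn.diffAt isOpen_indep (contDiffOn_phiBarVec k) hp.2.2)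
  exact h1.mul ((diffAt_qA hp.2.2).inv (qA_pos hp.2.2).ne')

theorem D_profileFactor (hP : HasProfileOn k h η φ (profileDomain U)) {p : E n × E n}
    (hp : p ∈ good U) {w : E n × E n} (hw : D w qA p = 0) : D w (profileFactor k η) p =
      deriv η (phiBarVec k p) * D w (phiBarVec k) p / qA p := by
  have hA := qA_pos hp.2.2
  have l1 := hasDerivAt_line
    (ContDiffOn.diffAt isOpen_indep (contDiffOn_phiBarVec (n := n) k) hp.2.2) w
  have lA := line_qA hp.2.2 w
  have hη : HasDerivAt η (deriv η (phiBarVec k p)) (phiBarVec k (p + (0 : ℝ) • w)) := by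
    simpa using (differentiableAt_eta hP hp).hasDerivAt
  refine D_eq_of_line (differentiableAt_profileFactor hP hp)
    (((hη.comp 0 l1).div lA (by simpa using hA.ne')).congr_deriv ?_)
  simp only [hw, zero_smul, add_zero, mul_zero, sub_zero]
  field_simp

theorem D_profileFactor_transport (hP : HasProfileOn k h η φ (profileDomain U)) {p : E n × E n}
    (hp : p ∈ good U) : D (p.2, 0) (profileFactor k η) p =
      2 * coefT k p * D (0, p.1) (profileFactor k η) p := by
  rw [D_profileFactor hP hp (D_qA_left hp.2.2), D_profileFactor hP hp (D_qA_right hp.2.2),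
    D_phiBarVec_transport k hp.2.2]
  ring

/-- Moving y orthogonally to x fixes |x| and v, and F = v h(|x|) - v I(|x|, v/|y|). So only the
s-derivative of I enters, which is the given integrand; no derivative of h or of I in r is needed.
-/
theorem D_snd_of_orthogonal (hF : IsFinslerOn F U) (hS : IsSphericallySymmetricOn φ F U)
    (hP : HasProfileOn k h η φ (profileDomain U)) {p : E n × E n} (hp : p ∈ good U) {u : E n}
    (hu : inner ℝ p.1 u = (0 : ℝ)) :
    D (0, u) (unc F) p = profileFactor k η p * inner ℝ p.2 u := by
  obtain ⟨I, hI⟩ := hP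
  have hO := isOpen_good hF.isOpen
  have hi := hp.2.2
  have hb := norm_snd_pos hi
  have hA := qA_pos hi
  have hv := hp.2.1
  have lb : HasDerivAt (fun t : ℝ => ‖(p + t • ((0 : E n), u)).2‖) (inner ℝ p.2 u / ‖p.2‖) 0 := by
    have l := (hasDerivAt_line (diffAt_qb p) (0, u)).sqrt (by simpa using (qb_pos hi).ne')
    simp only [← norm_snd_eq] at l
    refine l.congr_deriv ?_
    rw [D_qb]
    simp only [zero_smul, add_zero]
    field_simp
  have hpath : ∀ᶠ t : ℝ in 𝓝 0, p + t • ((0 : E n), u) ∈ good U := by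
    have : Continuous (fun t : ℝ => p + t • ((0 : E n), u)) := by fun_prop
    exact this.continuousAt.eventually_mem (by simpa using hO.mem_nhds hp)
  obtain ⟨-, -, hId, -⟩ := hI _ _ (mem_profileDomain hp)
  rw [phiBar_eq k hi, sqrt_sq_sub_sq hi] at hId
  have ls : HasDerivAt (fun t : ℝ => qv p / ‖(p + t • ((0 : E n), u)).2‖)
      (-(qv p * (inner ℝ p.2 u / ‖p.2‖)) / ‖p.2‖ ^ 2) 0 := by
    have := (hasDerivAt_const (0 : ℝ) (qv p)).div lb (by simpa using hb.ne')
    refine this.congr_deriv ?_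
    simp
  have hId' : HasDerivAt (I ‖p.1‖) (η (phiBarVec k p) / ((qv p / ‖p.2‖) ^ 2 * (qA p / ‖p.2‖)))
      (qv p / ‖(p + (0 : ℝ) • ((0 : E n), u)).2‖) := by simpa using hId
  have lF := ((hId'.comp 0 ls).const_mul (qv p)).const_sub (qv p * h ‖p.1‖)
  refine D_eq_of_line (ContDiffOn.diffAt hF.isOpen hF.contDiffOn_unc hp.1)
    ((lF.congr_of_eventuallyEq ?_).congr_deriv ?_)
  · filter_upwards [hpath] with t ht
    have h1 := unc_eq hS ht.1
    have h2 := (hI _ _ (mem_profileDomain ht)).2.2.2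
    have h3 : qv (p + t • ((0 : E n), u)) = qv p := by
      simp [qv, inner_add_right, real_inner_smul_right, hu]
    have h4 : (p + t • ((0 : E n), u)).1 = p.1 := by simp
    have h5 := norm_snd_pos ht.2.2
    rw [h1, h2, h3, h4]
    simp only [Function.comp]
    field_simp
  · rw [profileFactor]
    field_simp

theorem D_snd_eq (hF : IsFinslerOn F U) (hS : IsSphericallySymmetricOn φ F U)
    (hP : HasProfileOn k h η φ (profileDomain U)) {p : E n × E n} (hp : p ∈ good U) (u : E n) :
    D (0, u) (unc F) p = profileFactor k η p * inner ℝ p.2 u +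
      (D (0, p.1) (unc F) p - profileFactor k η p * qv p) / qa p * inner ℝ p.1 u := by
  have ha := qa_pos hp.2.2
  have h1 := D_snd_of_orthogonal hF hS hP hp (u := u - (inner ℝ p.1 u / qa p : ℝ) • p.1) (by
    rw [inner_sub_right, real_inner_smul_right, show (inner ℝ p.1 p.1 : ℝ) = qa p from rfl]
    field_simp
    ring)
  rw [show ((0 : E n), u - (inner ℝ p.1 u / qa p : ℝ) • p.1) =
    (0, u) - (inner ℝ p.1 u / qa p : ℝ) • (0, p.1) by simp, D_sub_dir, D_smul_dir, inner_sub_right,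
    real_inner_smul_right, show (inner ℝ p.2 p.1 : ℝ) = qv p from real_inner_comm _ _,
    smul_eq_mul] at h1
  have h2 : D (0, u) (unc F) p = inner ℝ p.1 u / qa p * D (0, p.1) (unc F) p +
    profileFactor k η p * (inner ℝ p.2 u - inner ℝ p.1 u / qa p * qv p) := by linarith
  rw [h2]
  ring

/-- The equation of Rapcsák: `F` is projectively related to the spray `coefT k • x`. -/
theorem rapcsak (hF : IsFinslerOn F U) (hS : IsSphericallySymmetricOn φ F U)
    (hP : HasProfileOn k h η φ (profileDomain U)) {p : E n × E n} (hp : p ∈ good U) (u : E n) :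
    D (p.2, 0) (D (0, u) (unc F)) p - D (u, 0) (unc F) p =
      2 * coefT k p * D (0, p.1) (D (0, u) (unc F)) p := by
  have hU := hF.isOpen
  have hO := isOpen_good hU
  have hf := hF.contDiffOn_unc
  have ha := qa_pos hp.2.2
  have hx : p.1 ≠ 0 := norm_pos_iff.1 (norm_fst_pos hp.2.2)
  set N := profileFactor (n := n) k η
  -- The y-gradient of F is N y + W x. For u ⟂ x the rotation identity gives D_{(u,0)}F = W⟨y,u⟩,
  -- which cancels the W-term of the mixed derivative and leaves the transport equation for N.
  set W : E n × E n → ℝ := fun q => (D (0, q.1) (unc F) q - N q * qv q) / qa q with hW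
  have dN : DifferentiableAt ℝ N p := differentiableAt_profileFactor hP hp
  have dW : DifferentiableAt ℝ W p := by
    have h1 : ContDiffOn ℝ ∞ (fun q : E n × E n => D (0, q.1) (unc F) q) U :=
      contDiffOn_D_field (w := fun q : E n × E n => ((0 : E n), q.1)) hU hf
        (contDiffOn_const.prodMk contDiffOn_fst)
    exact ((ContDiffOn.diffAt hU h1 hp.1).sub (dN.mul (diffAt_qv p))).mul ((diffAt_qa p).inv ha.ne')
  have key : ∀ u, inner ℝ p.1 u = (0 : ℝ) →
      D (p.2, 0) (D (0, u) (unc F)) p - D (u, 0) (unc F) p =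
        2 * coefT k p * D (0, p.1) (D (0, u) (unc F)) p := by
    intro u hu
    have h1 : EqOn (D (0, u) (unc F)) (fun q => N q * inner ℝ q.2 u + W q * inner ℝ q.1 u)
        (good U) := fun q hq => D_snd_eq hF hS hP hq u
    have h2 : ∀ w, D w (D (0, u) (unc F)) p =
        N p * inner ℝ w.2 u + D w N p * inner ℝ p.2 u + W p * inner ℝ w.1 u := fun w => by
      have d2 : DifferentiableAt ℝ (fun q : E n × E n => (inner ℝ q.2 u : ℝ)) p :=
        differentiableAt_snd.inner ℝ (differentiableAt_const u)
      have d1 : DifferentiableAt ℝ (fun q : E n × E n => (inner ℝ q.1 u : ℝ)) p :=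
        differentiableAt_fst.inner ℝ (differentiableAt_const u)
      rw [D_congr hO h1 w hp, D_add (dN.fun_mul d2) (dW.fun_mul d1), D_mul dN d2, D_mul dW d1,
        D_eq_of_line d2 (line_inner_snd p w u), D_eq_of_line d1 (line_inner_fst p w u), hu]
      ring
    have h3 := D_rotation hF hS hp.1 hx hu
    have h4 : D (u, 0) (unc F) p = inner ℝ p.2 u * W p := by
      rw [D_snd_of_orthogonal hF hS hP hp hu] at h3
      rw [hW]
      field_simp
      linarith
    rw [h2, h2, h4]
    simp only [inner_zero_left, hu, mul_zero, zero_add, add_zero]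
    rw [show D (p.2, 0) N p = 2 * coefT k p * D (0, p.1) N p from D_profileFactor_transport hP hp]
    ring
  have hv := hp.2.1
  -- Since v ≠ 0, every u is a vector orthogonal to x plus a multiple of y. In the direction y both
  -- sides of the equation vanish because F has degree one.
  set α : ℝ := inner ℝ p.1 u / qv p with hα
  set u' := u - α • p.2 with hu'
  have hu'0 : inner ℝ p.1 u' = (0 : ℝ) := by
    rw [hu', inner_sub_right, real_inner_smul_right, show (inner ℝ p.1 p.2 : ℝ) = qv p from rfl, hα]
    field_simp
    ring
  have hdecomp : u = u' + α • p.2 := by rw [hu']; abel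
  have e1 : ((0 : E n), u) = (0, u') + α • (0, p.2) := by rw [hdecomp]; simp
  have e2 : (u, (0 : E n)) = (u', 0) + α • (p.2, 0) := by rw [hdecomp]; simp
  have e3 : ∀ w, D w (D (0, u) (unc F)) p = D w (D (0, u') (unc F)) p +
      α * D w (D (0, p.2) (unc F)) p := fun w => by
    rw [e1, D_D_add hU hf _ _ _ hp.1, D_D_smul hU hf _ _ _ hp.1, smul_eq_mul]
  have e4 := D_euler_D hU hf 1 (fun q hq => by rw [hF.D_euler_unc hq, one_mul]) hp.1 (p.2, 0)
  rw [e3, e3, e2, D_add_dir, D_smul_dir, D_comm hU hf (0, p.2) (p.2, 0) hp.1,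
    D_comm hU hf (0, p.2) (0, p.1) hp.1, hF.D_euler_D_unc hp.1, e4, smul_eq_mul]
  rw [show ((0 : E n), ((p.2, (0 : E n)) : E n × E n).2) = 0 from rfl, D_zero_dir]
  linear_combination key u' hu'0

theorem sprayVec_eq (hF : IsFinslerOn F U) (hS : IsSphericallySymmetricOn φ F U)
    (hP : HasProfileOn k h η φ (profileDomain U)) {p : E n × E n} (hp : p ∈ good U) :
    sprayVec F p = coefT k p • p.1 + IsFinslerOn.projFactor F (coefT k) p • p.2 :=
  hF.sprayVec_eq_of_rapcsak hp.1 (rapcsak hF hS hP hp)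

theorem hasScalarFlagCurvature_of_profile (hF : IsFinslerOn F U)
    (hS : IsSphericallySymmetricOn φ F U) (hP : HasProfileOn k h η φ (profileDomain U)) :
    HasScalarFlagCurvature F U := by
  refine hF.hasScalarFlagCurvature_of_good fun p hp => ?_
  have hT := (contDiffOn_coefT k).mono (good_subset_indep U)
  exact riemannVec_eq_of_eqOn (isOpen_good hF.isOpen) hT
    (hF.contDiffOn_projFactor (good_subset U) hT) (fun q hq => sprayVec_eq hF hS hP hq)
    (fun q hq => D_euler_coefT hq.2.2) (fun q hq u => coefT_curvature hq.2.2 u) hp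

theorem isProjectivelyFlatOn_of_profile (hF : IsFinslerOn F U)
    (hS : IsSphericallySymmetricOn φ F U) (hP : HasProfileOn 0 h η φ (profileDomain U)) :
    IsProjectivelyFlatOn F U := by
  refine hF.isProjectivelyFlatOn_of_good fun p hp =>
    ⟨IsFinslerOn.projFactor F (coefT 0) p, ?_⟩
  rw [sprayVec_eq hF hS hP hp]
  simp [coefT]

end Profile

/-! ### Third derivatives along a line -/

section LineCalculus

variable {V : Type*} [NormedAddCommGroup V] [NormedSpace ℝ V]

theorem eventually_mem_line {U : Set V} (hU : IsOpen U) {p : V} (hp : p ∈ U) (w : V) :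
    ∀ᶠ t : ℝ in 𝓝 0, p + t • w ∈ U := by
  have : Continuous (fun t : ℝ => p + t • w) := by fun_prop
  exact this.continuousAt.eventually_mem (by simpa using hU.mem_nhds hp)

theorem D_line_eventuallyEq {U : Set V} (hU : IsOpen U) {X : V → ℝ} (hX : ContDiffOn ℝ ∞ X U)
    {p : V} (hp : p ∈ U) (w : V) {h h' : ℝ → ℝ} (hh : ∀ t, HasDerivAt h (h' t) t)
    (heq : ∀ᶠ t : ℝ in 𝓝 0, X (p + t • w) = h t) :
    ∀ᶠ t : ℝ in 𝓝 0, D w X (p + t • w) = h' t := by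
  filter_upwards [heq.eventually_nhds, eventually_mem_line hU hp w] with t ht htU
  have hγ : HasDerivAt (fun t : ℝ => p + t • w) w t := by
    simpa using ((hasDerivAt_id t).smul_const w).const_add p
  exact D_eq_of_curve (γ := fun t : ℝ => p + t • w) (ContDiffOn.diffAt hU hX htU) hγ
    ((hh t).congr_of_eventuallyEq ht)

/-- The expansion αt√(a + et²) = α√a t + αe t³/(2√a) + … has third derivative 3αe/√a at zero. -/
theorem third_derivative_ne_zero {a e : ℝ} (ha : 0 < a) (he : 0 < e) {α : ℝ} (hα : α ≠ 0) (β : ℝ)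
    {U : Set V} (hU : IsOpen U) {X : V → ℝ} (hX : ContDiffOn ℝ ∞ X U) {p : V} (hp : p ∈ U) (w : V)
    (heq : ∀ᶠ t : ℝ in 𝓝 0, X (p + t • w) = α * t * √(a + e * t ^ 2) + β * t) :
    D w (D w (D w X)) p ≠ 0 := by
  have hpos : ∀ t : ℝ, 0 < a + e * t ^ 2 := fun t => by positivity
  have hRpos : ∀ t : ℝ, 0 < √(a + e * t ^ 2) := fun t => Real.sqrt_pos.2 (hpos t)
  have hR : ∀ t : ℝ, HasDerivAt (fun t : ℝ => √(a + e * t ^ 2)) (e * t / √(a + e * t ^ 2)) t := by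
    intro t
    have h1 : HasDerivAt (fun t : ℝ => a + e * t ^ 2) (e * (2 * t)) t := by
      simpa using ((hasDerivAt_pow 2 t).const_mul e).const_add a
    refine (h1.sqrt (hpos t).ne').congr_deriv ?_
    have := hRpos t
    field_simp
  have hid := fun t : ℝ => hasDerivAt_id' t
  have h1 : ∀ t, HasDerivAt (fun t : ℝ => α * t * √(a + e * t ^ 2) + β * t)
      (α * √(a + e * t ^ 2) + α * e * t ^ 2 / √(a + e * t ^ 2) + β) t := fun t => by
    refine ((((hid t).const_mul α).mul (hR t)).add ((hid t).const_mul β)).congr_deriv ?_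
    have := hRpos t
    field_simp
  have h2 : ∀ t, HasDerivAt
      (fun t : ℝ => α * √(a + e * t ^ 2) + α * e * t ^ 2 / √(a + e * t ^ 2) + β)
      (3 * α * e * t / √(a + e * t ^ 2) - α * e ^ 2 * t ^ 3 / √(a + e * t ^ 2) ^ 3) t := fun t => by
    refine (((hR t).const_mul α).add (((hasDerivAt_pow 2 t).const_mul (α * e)).div (hR t)
      (hRpos t).ne')).add_const β |>.congr_deriv ?_
    have := hRpos t
    push_cast
    field_simp
    ring
  have h3 : HasDerivAt
      (fun t : ℝ => 3 * α * e * t / √(a + e * t ^ 2) - α * e ^ 2 * t ^ 3 / √(a + e * t ^ 2) ^ 3)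
      (3 * α * e / √a) 0 := by
    refine ((((hid 0).const_mul (3 * α * e)).div (hR 0) (hRpos 0).ne').sub
      (((hasDerivAt_pow 3 (0 : ℝ)).const_mul (α * e ^ 2)).div ((hR 0).pow 3)
        (pow_ne_zero 3 (hRpos 0).ne'))).congr_deriv ?_
    have : 0 < √a := Real.sqrt_pos.2 ha
    simp
    field_simp
  have hX1 := contDiffOn_D hU hX w
  have e1 := D_line_eventuallyEq hU hX hp w h1 heq
  have e2 := D_line_eventuallyEq hU hX1 hp w h2 e1
  have e3 : D w (D w (D w X)) p = 3 * α * e / √a :=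
    D_eq_of_line (ContDiffOn.diffAt hU (contDiffOn_D hU hX1 w) hp) (h3.congr_of_eventuallyEq e2)
  have : 0 < √a := Real.sqrt_pos.2 ha
  rw [e3]
  positivity

theorem D_sum_mul {ι : Type*} [Fintype ι] {X : ι → V → ℝ} {p : V}
    (hX : ∀ i, DifferentiableAt ℝ (X i) p) (c : ι → ℝ) (w : V) :
    D w (fun q => ∑ i, c i * X i q) p = ∑ i, c i * D w (X i) p := by
  unfold D
  rw [fderiv_fun_sum fun i _ => (hX i).const_mul (c i)]
  simp only [sum_apply]
  refine Finset.sum_congr rfl fun i _ => ?_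
  exact D_const_mul (hX i) (c i) w

end LineCalculus

/-! ### Douglas curvature -/

/-- The function whose third `y`-derivatives are the Douglas curvature. -/
def douglasPotential (F : E n → E n → ℝ) (i : Fin n) (x y : E n) : ℝ :=
  spray F i x y - (1 / ((n : ℝ) + 1)) * (∑ p, dy p (spray F p) x y) * y i

theorem D_D_D_eq_zero {U : Set (E n × E n)} (hU : IsOpen U) {f : E n → E n → ℝ}
    (hf : ContDiffOn ℝ ∞ (unc f) U)
    (h : ∀ p ∈ U, ∀ j m l, dy j (dy m (dy l f)) p.1 p.2 = 0) (u : E n) {p : E n × E n}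
    (hp : p ∈ U) : D (0, u) (D (0, u) (D (0, u) (unc f))) p = 0 := by
  have h1 : EqOn (D (0, u) (D (0, u) (unc f)))
      (fun q => ∑ l, u l * D (0, u) (unc (dy l f)) q) U := fun q hq =>
    (sum_D_dy hU hf hq (0, u) u).symm
  have hl := fun l => contDiffOn_dy hU hf l
  rw [D_congr hU h1 _ hp, D_sum_mul fun l => ContDiffOn.diffAt hU (contDiffOn_D hU (hl l) _) hp]
  refine Finset.sum_eq_zero fun l _ => ?_
  rw [← sum_dy_dy hU (hl l) hp]
  simp [h p hp]

namespace IsFinslerOn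

variable {F : E n → E n → ℝ} {U : Set (E n × E n)}

theorem contDiffOn_douglasPotential (hF : IsFinslerOn F U) (i : Fin n) :
    ContDiffOn ℝ ∞ (unc (douglasPotential F i)) U :=
  (hF.contDiffOn_spray i).sub ((contDiffOn_const.mul (ContDiffOn.sum fun p _ =>
    contDiffOn_dy hF.isOpen (hF.contDiffOn_spray p) p)).mul
      (contDiffOn_euclidean.1 contDiffOn_snd i))

/-- P has degree one in y. Hence the y-divergence of P y is (n+1)P, which is what the factor 1/(n+1)
in the Douglas curvature cancels. -/
theorem D_euler_projFactor (hF : IsFinslerOn F U) {O : Set (E n × E n)} (hO : IsOpen O)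
    (hOU : O ⊆ U) {T : E n × E n → ℝ} (hT : ContDiffOn ℝ ∞ T O) {p : E n × E n} (hp : p ∈ O)
    (hT2 : D (0, p.2) T p = 2 * T p) :
    D (0, p.2) (projFactor F T) p = projFactor F T p := by
  have hU := hF.isOpen
  have hpU := hOU hp
  have hf := hF.contDiffOn_unc
  have hFp : unc F p ≠ 0 := (hF.pos _ _ hpU).ne'
  have w1 : ContDiffOn ℝ ∞ (fun p : E n × E n => (p.2, (0 : E n))) U :=
    contDiffOn_snd.prodMk contDiffOn_const
  have w2 : ContDiffOn ℝ ∞ (fun p : E n × E n => ((0 : E n), p.1)) U :=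
    contDiffOn_const.prodMk contDiffOn_fst
  have d1 := ContDiffOn.diffAt hU (contDiffOn_D_field hU hf w1) hpU
  have d2 := ContDiffOn.diffAt hU (contDiffOn_D_field hU hf w2) hpU
  have dT := ContDiffOn.diffAt hO hT hp
  have dP := ContDiffOn.diffAt hO (hF.contDiffOn_projFactor hOU hT) hp
  have dF := ContDiffOn.diffAt hU hf hpU
  have hPF : EqOn (fun q => projFactor F T q * unc F q)
      (fun q => (1 / 2) * D (q.2, 0) (unc F) q - T q * D (0, q.1) (unc F) q) O := fun q hq => by
    have : unc F q ≠ 0 := (hF.pos _ _ (hOU hq)).ne'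
    simp only [projFactor]
    field_simp
  have e1 : D (0, p.2) (fun q : E n × E n => (q.2, (0 : E n))) p = (p.2, 0) :=
    D_clm ((ContinuousLinearMap.inl ℝ (E n) (E n)).comp (ContinuousLinearMap.snd ℝ (E n) (E n)))
      _ p
  have e2 : D (0, p.2) (fun q : E n × E n => ((0 : E n), q.1)) p = 0 :=
    D_clm ((ContinuousLinearMap.inr ℝ (E n) (E n)).comp (ContinuousLinearMap.fst ℝ (E n) (E n)))
      (0, p.2) p
  have h1 := D_congr hO hPF (0, p.2) hp
  have e3 := D_euler_D hU hf 1 (fun q hq => by rw [hF.D_euler_unc hq, one_mul]) hpU (p.2, 0)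
  rw [show ((0 : E n), ((p.2, (0 : E n)) : E n × E n).2) = 0 from rfl, D_zero_dir] at e3
  rw [D_mul dP dF, D_sub (d1.const_mul _) (dT.fun_mul d2), D_const_mul d1, D_mul dT d2,
    D_field (w := fun q : E n × E n => (q.2, (0 : E n))) hU hf (by fun_prop) _ hpU,
    D_field (w := fun q : E n × E n => ((0 : E n), q.1)) hU hf (by fun_prop) _ hpU, e1, e2,
    D_zero_dir, e3, hF.D_euler_D_unc hpU, hT2, hF.D_euler_unc hpU] at h1
  have h2 := hPF hp
  simp only at h2
  apply mul_right_cancel₀ hFp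
  linarith

end IsFinslerOn

section Douglas

variable {k : ℝ} {h η : ℝ → ℝ} {φ : ℝ → ℝ → ℝ} {F : E n → E n → ℝ} {U : Set (E n × E n)}

/-- The y-divergence of G is D_{(0,x)}T + (n+1)P, so P drops out and with it all dependence on h and
η. -/
theorem douglasPotential_eq (hF : IsFinslerOn F U) (hS : IsSphericallySymmetricOn φ F U)
    (hP : HasProfileOn k h η φ (profileDomain U)) {p : E n × E n} (hp : p ∈ good U) (i : Fin n) :
    unc (douglasPotential F i) p = coefT k p * p.1 i -
      (1 / ((n : ℝ) + 1)) * ((k * qA p - k ^ 2 * qv p) / qa p) * p.2 i := by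
  have hU := hF.isOpen
  have hO := isOpen_good hU
  have hT := (contDiffOn_coefT k).mono (good_subset_indep U)
  have hpr := hF.contDiffOn_projFactor (good_subset U) hT
  have dT := ContDiffOn.diffAt hO hT hp
  have dP := ContDiffOn.diffAt hO hpr hp
  have hG : EqOn (sprayVec F)
      (fun p => coefT k p • p.1 + IsFinslerOn.projFactor F (coefT k) p • p.2)
      (good U) := fun q hq => sprayVec_eq hF hS hP hq
  have hsum : ∑ j, dy j (spray F j) p.1 p.2 = D (0, p.1) (coefT k) p +
      ((n : ℝ) + 1) * IsFinslerOn.projFactor F (coefT k) p := by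
    have h1 : ∀ j, dy j (spray F j) p.1 p.2 =
        p.1 j * D (0, EuclideanSpace.single j (1 : ℝ)) (coefT k) p
        + (IsFinslerOn.projFactor F (coefT k) p
        + p.2 j * D (0, EuclideanSpace.single j (1 : ℝ))
          (IsFinslerOn.projFactor F (coefT k)) p) := by
      intro j
      have e1 := eqOn_dy hU (hF.contDiffOn_spray j) j hp.1
      have e2 := D_apply (ContDiffOn.diffAt hU hF.contDiffOn_sprayVec hp.1)
        (0, EuclideanSpace.single j (1 : ℝ)) j
      rw [D_congr hO hG _ hp, D_combination dT dP] at e2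
      refine e1.trans (e2.symm.trans ?_)
      simp
      ring
    rw [Finset.sum_congr rfl fun j _ => h1 j, Finset.sum_add_distrib, Finset.sum_add_distrib]
    have e3 := D_snd_eq_sum p.1 (coefT k) p
    have e4 := D_snd_eq_sum p.2 (IsFinslerOn.projFactor F (coefT k)) p
    simp only [smul_eq_mul] at e3 e4
    rw [← e3, ← e4, hF.D_euler_projFactor hO (good_subset U) hT hp (D_euler_coefT hp.2.2)]
    simp
    ring
  have hs : spray F i p.1 p.2 = coefT k p * p.1 i +
      IsFinslerOn.projFactor F (coefT k) p * p.2 i := by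
    have : sprayVec F p i = _ := congrArg (fun v : E n => v i) (hG hp)
    exact (show spray F i p.1 p.2 = sprayVec F p i from rfl).trans (by simpa using this)
  change douglasPotential F i p.1 p.2 = _
  rw [douglasPotential, hsum, hs, D_radial_coefT hp.2.2]
  have : (n : ℝ) + 1 ≠ 0 := by positivity
  field_simp
  ring

theorem not_isDouglasOn_of_profile (hF : IsFinslerOn F U)
    (hS : IsSphericallySymmetricOn φ F U) (hP : HasProfileOn k h η φ (profileDomain U))
    (hn : 3 ≤ n) (hk : k ≠ 0) (hne : U.Nonempty) : ¬ IsDouglasOn F U := by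
  intro hD
  have hU := hF.isOpen
  have hO := isOpen_good hU
  -- If there were no good pairs, the constant 1 would vanish on all of them and hence on U.
  obtain ⟨p, hp⟩ : (good U).Nonempty := by
    by_contra hemp
    rw [not_nonempty_iff_eq_empty] at hemp
    obtain ⟨q, hq⟩ := hne
    exact one_ne_zero (eq_zero_of_good hU (fun p hp => hF.ne_zero _ _ hp) (by omega)
      (g := fun _ => (1 : ℝ)) continuousOn_const (by simp [hemp]) hq)
  -- Here n ≥ 3 enters. Contracting the potential with f kills the x-term and, along y + tf, leaves
  -- -t|f|²(kA - k²v)/((n+1)a), where A² = `gram p` + a|f|²t² and v is constant.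
  obtain ⟨f, hf0, hfo⟩ := exists_orthogonal {p.1, p.2}
    (lt_of_le_of_lt Finset.card_le_two (by omega))
  have hxf : inner ℝ p.1 f = (0 : ℝ) := hfo _ (by simp)
  have hyf : inner ℝ p.2 f = (0 : ℝ) := hfo _ (by simp)
  have hc : 0 < (inner ℝ f f : ℝ) := real_inner_self_pos.2 hf0
  have ha := qa_pos hp.2.2
  have hA := qA_pos hp.2.2
  set X : E n × E n → ℝ := fun q => ∑ i, f i * unc (douglasPotential F i) q with hX
  have hpot := fun i => hF.contDiffOn_douglasPotential i
  have hXs : ContDiffOn ℝ ∞ X U :=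
    ContDiffOn.sum fun i _ => contDiffOn_const.mul (hpot i)
  have hzero : D (0, f) (D (0, f) (D (0, f) X)) p = 0 := by
    have e1 : EqOn (D (0, f) X) (fun q => ∑ i, f i * D (0, f) (unc (douglasPotential F i)) q) U :=
      fun q hq => D_sum_mul (fun i => ContDiffOn.diffAt hU (hpot i) hq) _ _
    have hp1 := fun i => contDiffOn_D hU (hpot i) (0, f)
    have e2 : EqOn (D (0, f) (D (0, f) X))
        (fun q => ∑ i, f i * D (0, f) (D (0, f) (unc (douglasPotential F i))) q) U := fun q hq =>
      (D_congr hU e1 _ hq).trans (D_sum_mul (fun i => ContDiffOn.diffAt hU (hp1 i) hq) _ _)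
    rw [D_congr hU e2 _ hp.1,
      D_sum_mul fun i => ContDiffOn.diffAt hU (contDiffOn_D hU (hp1 i) (0, f)) hp.1]
    refine Finset.sum_eq_zero fun i _ => ?_
    rw [D_D_D_eq_zero hU (hpot i) (fun q hq j m l => hD q.1 q.2 hq i j m l) f hp.1, mul_zero]
  have hn1 : (0 : ℝ) < (n : ℝ) + 1 := by positivity
  refine third_derivative_ne_zero (a := gram p) (e := qa p * inner ℝ f f) hp.2.2 (mul_pos ha hc)
    (α := -(1 / ((n : ℝ) + 1)) * k * inner ℝ f f / qa p) ?_
    ((1 / ((n : ℝ) + 1)) * k ^ 2 * qv p * inner ℝ f f / qa p) hU hXs hp.1 (0, f) ?_ hzero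
  · have := hc.ne'
    have := ha.ne'
    have := hn1.ne'
    refine div_ne_zero (mul_ne_zero (mul_ne_zero (neg_ne_zero.2 ?_) hk) hc.ne') ha.ne'
    positivity
  · filter_upwards [eventually_mem_line hO hp (0, f)] with t ht
    have h1 : (p + t • ((0 : E n), f)).1 = p.1 := by simp
    have h2 : (p + t • ((0 : E n), f)).2 = p.2 + t • f := by simp
    have h3 : qa (p + t • ((0 : E n), f)) = qa p := by rw [qa, h1]; rfl
    have h4 : qv (p + t • ((0 : E n), f)) = qv p := by
      rw [qv, h1, h2, inner_add_right, real_inner_smul_right, hxf]; simp [qv]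
    have h5 : qb (p + t • ((0 : E n), f)) = qb p + t ^ 2 * inner ℝ f f := by
      rw [qb, h2, inner_add_left, inner_add_right, inner_add_right, real_inner_smul_right,
        real_inner_smul_left, real_inner_smul_left, real_inner_smul_right,
        real_inner_comm p.2 f, hyf, qb]
      ring
    have h6 : qA (p + t • ((0 : E n), f)) = √(gram p + qa p * inner ℝ f f * t ^ 2) := by
      rw [qA, gram, h3, h4, h5, gram]
      congr 1
      ring
    have h7 : ∑ i, f i * p.1 i = 0 := by
      have := hxf
      simpa [PiLp.inner_apply] using this
    have h8 : ∑ i, f i * p.2 i = 0 := by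
      have := hyf
      simpa [PiLp.inner_apply] using this
    have h9 : ∑ i, f i * f i = inner ℝ f f := by
      simp only [PiLp.inner_apply, RCLike.inner_apply, conj_trivial]
    have h10 : ∀ c d : ℝ, ∑ i, f i * (c * p.1 i - d * (p.2 + t • f) i) =
        -d * t * inner ℝ f f := fun c d => by
      have : ∀ i, f i * (c * p.1 i - d * (p.2 + t • f) i) =
          c * (f i * p.1 i) - d * (f i * p.2 i) - d * t * (f i * f i) := fun i => by
        simp only [PiLp.add_apply, PiLp.smul_apply, smul_eq_mul]; ring
      rw [Finset.sum_congr rfl fun i _ => this i, Finset.sum_sub_distrib, Finset.sum_sub_distrib,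
        ← Finset.mul_sum, ← Finset.mul_sum, ← Finset.mul_sum, h7, h8, h9]
      ring
    simp only [hX, douglasPotential_eq hF hS hP ht, h1, h2, h3, h4, h6, h10]
    field_simp
    ring

end Douglas

/-! ### One-variable functions of the model metric -/

section ModelFunctions

/-- The exponential factor of the model metric, as a function of `⟨x, y⟩ / A`. -/
def modelExp (k p : ℝ) : ℝ := Real.exp (2 * k * Real.arctan (k - (1 + k ^ 2) * p))

/-- The quadratic polynomial `1 - 2kp + (1 + k²)p²`. -/
def modelQuad (k p : ℝ) : ℝ := 1 - 2 * k * p + (1 + k ^ 2) * p ^ 2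

/-- The profile of the model metric. -/
def modelProfile (k p : ℝ) : ℝ :=
  modelExp k p * (1 - (k ^ 2 + 1) / (2 * k) * p) + modelExp k 0 * (5 * k ^ 2 + 1) / (2 * k) * p

/-- The derivative of `modelProfile`. -/
def modelSlope (k p : ℝ) : ℝ :=
  modelExp k p * (-2 * k * (1 - (k ^ 2 + 1) / (2 * k) * p) / modelQuad k p - (k ^ 2 + 1) / (2 * k))
    + modelExp k 0 * (5 * k ^ 2 + 1) / (2 * k)

theorem modelExp_pos (k p : ℝ) : 0 < modelExp k p := Real.exp_pos _

theorem modelQuad_pos (k p : ℝ) : 0 < modelQuad k p := by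
  have h : modelQuad k p = (1 - k * p) ^ 2 + p ^ 2 := by rw [modelQuad]; ring
  rw [h]
  by_cases hp : p = 0
  · simp [hp]
  · positivity

theorem hasDerivAt_modelExp (k p : ℝ) :
    HasDerivAt (modelExp k) (-2 * k * modelExp k p / modelQuad k p) p := by
  have h := ((((hasDerivAt_id' p).const_mul (1 + k ^ 2)).const_sub k).arctan.const_mul (2 * k)).exp
  refine h.congr_deriv ?_
  have hz : 1 + (k - (1 + k ^ 2) * p) ^ 2 = (1 + k ^ 2) * modelQuad k p := by
    rw [modelQuad]; ring
  have := modelQuad_pos k p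
  rw [hz, modelExp]
  field_simp

theorem hasDerivAt_modelQuad (k p : ℝ) :
    HasDerivAt (modelQuad k) (-2 * k + 2 * (1 + k ^ 2) * p) p := by
  have h := (((hasDerivAt_id' p).const_mul (2 * k)).const_sub 1).add
    ((hasDerivAt_pow 2 p).const_mul (1 + k ^ 2))
  refine h.congr_deriv ?_
  simp
  ring

theorem hasDerivAt_modelProfile (k p : ℝ) :
    HasDerivAt (modelProfile k) (modelSlope k p) p := by
  have h := ((hasDerivAt_modelExp k p).mul
    (((hasDerivAt_id' p).const_mul ((k ^ 2 + 1) / (2 * k))).const_sub 1)).add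
    ((hasDerivAt_id' p).const_mul (modelExp k 0 * (5 * k ^ 2 + 1) / (2 * k)))
  refine h.congr_deriv ?_
  rw [modelSlope]
  ring

/-- For h = 0 and η the identity, the integral formula says φ - sφ_s = φ̄/√(r² - s²). With φ =
r^{2k²}√(r² - s²) L(p) and p = s/√(r² - s²), it becomes this linear equation for L. Its solutions
differ by multiples of p. -/
theorem modelProfile_sub {k : ℝ} (hk : k ≠ 0) (p : ℝ) :
    modelProfile k p - p * modelSlope k p = modelExp k p / modelQuad k p := by
  have := (modelQuad_pos k p).ne'
  rw [modelProfile, modelSlope]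
  field_simp
  rw [modelQuad]
  ring

theorem hasDerivAt_modelExp_div (k p : ℝ) :
    HasDerivAt (fun p => modelExp k p / modelQuad k p)
      (-p * (2 * (1 + k ^ 2) * modelExp k p / modelQuad k p ^ 2)) p := by
  have := (modelQuad_pos k p).ne'
  refine ((hasDerivAt_modelExp k p).div (hasDerivAt_modelQuad k p) this).congr_deriv ?_
  field_simp
  ring

theorem hasDerivAt_modelSlope {k : ℝ} (hk : k ≠ 0) (p : ℝ) :
    HasDerivAt (modelSlope k) (2 * (1 + k ^ 2) * modelExp k p / modelQuad k p ^ 2) p := by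
  have := (modelQuad_pos k p).ne'
  have h := ((hasDerivAt_modelExp k p).mul ((((((hasDerivAt_id' p).const_mul
    ((k ^ 2 + 1) / (2 * k))).const_sub 1).const_mul (-2 * k)).div (hasDerivAt_modelQuad k p)
    this).sub_const ((k ^ 2 + 1) / (2 * k)))).add_const
    (modelExp k 0 * (5 * k ^ 2 + 1) / (2 * k))
  refine h.congr_deriv ?_
  simp only [Pi.div_apply]
  field_simp
  rw [modelQuad]
  ring

/-- The multiple of p in L is chosen so that L'(0) = 0. As L' is increasing, pL' ≥ 0, and L - pL' >
0 gives the claim. -/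
theorem modelProfile_pos {k : ℝ} (hk : k ≠ 0) (p : ℝ) : 0 < modelProfile k p := by
  have hmono : Monotone (modelSlope k) := monotone_of_hasDerivAt_nonneg
    (fun p => hasDerivAt_modelSlope hk p) fun p => by
      have := modelExp_pos k p
      have := modelQuad_pos k p
      positivity
  have h0 : modelSlope k 0 = 0 := by
    rw [modelSlope, modelQuad]
    field_simp
    ring
  have h1 : 0 ≤ p * modelSlope k p := by
    rcases le_total 0 p with hp | hp
    · exact mul_nonneg hp (h0 ▸ hmono hp)
    · exact mul_nonneg_of_nonpos_of_nonpos hp (h0 ▸ hmono hp)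
  have h2 := modelProfile_sub hk p
  have h3 := div_pos (modelExp_pos k p) (modelQuad_pos k p)
  linarith

theorem contDiff_modelProfile (k : ℝ) : ContDiff ℝ ∞ (modelProfile k) := by
  have h : ContDiff ℝ ∞ (modelExp k) :=
    (contDiff_const.mul (Real.contDiff_arctan.comp
      (contDiff_const.sub (contDiff_const.mul contDiff_id)))).exp
  exact (h.mul (contDiff_const.sub (contDiff_const.mul contDiff_id))).add
    (contDiff_const.mul contDiff_id)

end ModelFunctions

/-! ### The model metric -/

section Model

variable {k : ℝ}

/-- The model metric `|x|^(2k²) A L(⟨x, y⟩ / A)`. -/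
def model (k : ℝ) (x y : E n) : ℝ :=
  qa (x, y) ^ (k ^ 2) * qA (x, y) * modelProfile k (qv (x, y) / qA (x, y))

/-- The profile `φ(r, s)` of the model metric. -/
def modelPhi (k r s : ℝ) : ℝ :=
  (r ^ 2) ^ (k ^ 2) * √(r ^ 2 - s ^ 2) * modelProfile k (s / √(r ^ 2 - s ^ 2))

theorem nonRadial_eq_indep : nonRadial n = indep n := by
  ext p
  constructor
  · intro h
    have h' : LinearIndependent ℝ ![p.1, p.2] := h
    rw [LinearIndependent.pair_iff] at h'
    have hy : p.2 ≠ 0 := by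
      intro hy
      have := h' 0 1 (by simp [hy])
      simp at this
    have hb : 0 < qb p := real_inner_self_pos.2 hy
    have hw : qb p • p.1 - qv p • p.2 ≠ 0 := by
      intro hw
      have := h' (qb p) (-qv p) (by rw [← hw]; module)
      exact hb.ne' this.1
    have hww : (inner ℝ (qb p • p.1 - qv p • p.2) (qb p • p.1 - qv p • p.2) : ℝ) =
        qb p * gram p := by
      simp only [inner_sub_left, inner_sub_right, real_inner_smul_left, real_inner_smul_right,
        gram, qa, qv, qb, real_inner_comm p.1 p.2]
      ring
    exact pos_of_mul_pos_right (hww ▸ real_inner_self_pos.2 hw) hb.le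
  · intro h
    have h0 : 0 < gram p := h
    change LinearIndependent ℝ ![p.1, p.2]
    rw [LinearIndependent.pair_iff]
    intro s t hst
    have h1 : s * qa p + t * qv p = 0 := by
      have : (inner ℝ (s • p.1 + t • p.2) p.1 : ℝ) = 0 := by rw [hst, inner_zero_left]
      rwa [inner_add_left, real_inner_smul_left, real_inner_smul_left,
        real_inner_comm p.1 p.2] at this
    have h2 : s * qv p + t * qb p = 0 := by
      have : (inner ℝ (s • p.1 + t • p.2) p.2 : ℝ) = 0 := by rw [hst, inner_zero_left]
      rwa [inner_add_left, real_inner_smul_left, real_inner_smul_left] at this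
    constructor
    · apply (mul_eq_zero.1 (?_ : s * gram p = 0)).resolve_right h0.ne'
      rw [gram]; linear_combination qb p * h1 - qv p * h2
    · apply (mul_eq_zero.1 (?_ : t * gram p = 0)).resolve_right h0.ne'
      rw [gram]; linear_combination qa p * h2 - qv p * h1

theorem contDiffOn_model (k : ℝ) : ContDiffOn ℝ ∞ (unc (model (n := n) k)) (indep n) :=
  ((contDiff_qa.contDiffOn.rpow_const_of_ne fun _ hp => (qa_pos hp).ne').mul contDiffOn_qA).mul
    ((contDiff_modelProfile k).comp_contDiffOn
      (contDiff_qv.contDiffOn.div contDiffOn_qA fun _ hp => (qA_pos hp).ne'))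

theorem model_pos (hk : k ≠ 0) {p : E n × E n} (hp : p ∈ indep n) : 0 < unc (model k) p :=
  mul_pos (mul_pos (Real.rpow_pos_of_pos (qa_pos hp) _) (qA_pos hp)) (modelProfile_pos hk _)

/-- The derivative of the model metric in the direction `(0, u)`. -/
def modelDeriv (k : ℝ) (u : E n) (p : E n × E n) : ℝ :=
  qa p ^ (k ^ 2) * (modelExp k (qv p / qA p) / modelQuad k (qv p / qA p) *
    ((qa p * inner ℝ p.2 u - qv p * inner ℝ p.1 u) / qA p) +
      modelSlope k (qv p / qA p) * inner ℝ p.1 u)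

theorem D_snd_qA {p : E n × E n} (hp : p ∈ indep n) (u : E n) :
    D (0, u) qA p = (qa p * inner ℝ p.2 u - qv p * inner ℝ p.1 u) / qA p := by
  have := qA_pos hp
  rw [D_qA _ hp, D_qv, D_qa, D_qb, inner_zero_left, inner_zero_right]
  field_simp
  ring

theorem D_snd_model (hk : k ≠ 0) {p : E n × E n} (hp : p ∈ indep n) (u : E n) :
    D (0, u) (unc (model k)) p = modelDeriv k u p := by
  have ha := qa_pos hp
  have hA := qA_pos hp
  have lv := hasDerivAt_line (diffAt_qv p) (0, u)
  have la := hasDerivAt_line (diffAt_qa p) (0, u)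
  have lA := line_qA hp (0, u)
  rw [D_qv, inner_zero_left, zero_add] at lv
  rw [D_qa, inner_zero_right, mul_zero] at la
  have lp := lv.div lA (by simpa using hA.ne')
  have lL : HasDerivAt (modelProfile k) (modelSlope k (qv p / qA p))
      (qv (p + (0 : ℝ) • ((0 : E n), u)) / qA (p + (0 : ℝ) • ((0 : E n), u))) := by
    simpa using hasDerivAt_modelProfile k (qv p / qA p)
  have l := ((la.rpow_const (p := k ^ 2) (Or.inl (by simpa using ha.ne'))).mul lA).mul
    (lL.comp 0 lp)
  refine D_eq_of_line (ContDiffOn.diffAt isOpen_indep (contDiffOn_model k) hp) (l.congr_deriv ?_)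
  simp only [zero_smul, add_zero, zero_mul, zero_add, Pi.div_apply, Pi.mul_apply, Function.comp]
  rw [modelDeriv, D_snd_qA hp, ← modelProfile_sub hk]
  field_simp
  ring

theorem contDiffOn_modelDeriv (hk : k ≠ 0) (u : E n) :
    ContDiffOn ℝ ∞ (modelDeriv k u) (indep n) :=
  (contDiffOn_D isOpen_indep (contDiffOn_model k) (0, u)).congr
    fun _ hp => (D_snd_model hk hp u).symm

/-- For F = R A L(p) with p = v/A and R constant in y, F'' = R(A p'² L'' + A''(L - pL')). Moreover
A² is quadratic in y, so AA'' + A'² = a|u|² - ⟨x,u⟩². -/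
theorem D_D_snd_model (hk : k ≠ 0) {p : E n × E n} (hp : p ∈ indep n) (u : E n) :
    D (0, u) (D (0, u) (unc (model k))) p = qa p ^ (k ^ 2) / qA p *
      (2 * (1 + k ^ 2) * modelExp k (qv p / qA p) / modelQuad k (qv p / qA p) ^ 2 *
        (inner ℝ p.1 u - qv p / qA p * D (0, u) qA p) ^ 2 +
      modelExp k (qv p / qA p) / modelQuad k (qv p / qA p) *
        (qa p * inner ℝ u u - (inner ℝ p.1 u) ^ 2 - (D (0, u) qA p) ^ 2)) := by
  rw [D_congr isOpen_indep (fun q hq => D_snd_model hk hq u) _ hp]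
  have ha := qa_pos hp
  have hA := qA_pos hp
  have lv := hasDerivAt_line (diffAt_qv p) (0, u)
  have la := hasDerivAt_line (diffAt_qa p) (0, u)
  have lA := line_qA hp (0, u)
  have lx := line_inner_fst p (0, u) u
  have ly := line_inner_snd p (0, u) u
  rw [inner_zero_left] at lx
  rw [D_qv, inner_zero_left, zero_add] at lv
  rw [D_qa, inner_zero_right, mul_zero] at la
  have lp := lv.div lA (by simpa using hA.ne')
  have lK : HasDerivAt (modelSlope k) (2 * (1 + k ^ 2) * modelExp k (qv p / qA p) /
      modelQuad k (qv p / qA p) ^ 2)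
      (qv (p + (0 : ℝ) • ((0 : E n), u)) / qA (p + (0 : ℝ) • ((0 : E n), u))) := by
    simpa using hasDerivAt_modelSlope hk (qv p / qA p)
  have lJ : HasDerivAt (fun p => modelExp k p / modelQuad k p)
      (-(qv p / qA p) * (2 * (1 + k ^ 2) * modelExp k (qv p / qA p) /
        modelQuad k (qv p / qA p) ^ 2))
      (qv (p + (0 : ℝ) • ((0 : E n), u)) / qA (p + (0 : ℝ) • ((0 : E n), u))) := by
    simpa using hasDerivAt_modelExp_div k (qv p / qA p)
  have l := (la.rpow_const (p := k ^ 2) (Or.inl (by simpa using ha.ne'))).mul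
    (((lJ.comp 0 lp).mul (((la.mul ly).sub (lv.mul lx)).div lA (by simpa using hA.ne'))).add
      ((lK.comp 0 lp).mul lx))
  refine D_eq_of_line (ContDiffOn.diffAt isOpen_indep (contDiffOn_modelDeriv hk u) hp)
    (l.congr_deriv ?_)
  simp only [zero_smul, add_zero, zero_mul, zero_add, Pi.div_apply, Pi.mul_apply, Pi.sub_apply,
    Function.comp, mul_zero]
  have hQ := (modelQuad_pos k (qv p / qA p)).ne'
  rw [D_snd_qA hp]
  set X := modelExp k (qv p / qA p)
  set Q := modelQuad k (qv p / qA p)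
  set R := qa p ^ (k ^ 2)
  field_simp
  ring

/-- The area form satisfies the Cauchy–Schwarz inequality. -/
theorem sq_D_snd_qA_le {p : E n × E n} (hp : p ∈ indep n) (u : E n) :
    (D (0, u) qA p) ^ 2 ≤ qa p * inner ℝ u u - (inner ℝ p.1 u) ^ 2 := by
  have ha := qa_pos hp
  have hA := qA_pos hp
  have hcs := real_inner_mul_inner_self_le (qa p • p.2 - qv p • p.1)
    (qa p • u - (inner ℝ p.1 u : ℝ) • p.1)
  have e1 : (inner ℝ p.1 p.1 : ℝ) = qa p := rfl
  have e2 : (inner ℝ p.2 p.1 : ℝ) = qv p := real_inner_comm _ _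
  have e3 : (inner ℝ p.1 p.2 : ℝ) = qv p := rfl
  have e4 : (inner ℝ p.2 p.2 : ℝ) = qb p := rfl
  have e5 : (inner ℝ u p.1 : ℝ) = inner ℝ p.1 u := real_inner_comm _ _
  simp only [inner_sub_left, inner_sub_right, real_inner_smul_left, real_inner_smul_right, e1, e2,
    e3, e4, e5, qb_eq hp] at hcs
  rw [D_snd_qA hp, div_pow, div_le_iff₀ (by positivity)]
  refine le_of_mul_le_mul_left ?_ (show 0 < qa p ^ 2 by positivity)
  refine le_of_eq_of_le ?_ (hcs.trans_eq ?_)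
  · ring
  · field_simp
    ring

theorem D_D_snd_en_model_pos (hk : k ≠ 0) {p : E n × E n} (hp : p ∈ indep n) {u : E n}
    (hu : u ≠ 0) : 0 < D (0, u) (D (0, u) (en (model k))) p := by
  have ha := qa_pos hp
  have hA := qA_pos hp
  have hf := contDiffOn_model (n := n) k
  have hE := modelExp_pos k (qv p / qA p)
  have hQ := modelQuad_pos k (qv p / qA p)
  have hR : 0 < qa p ^ (k ^ 2) := Real.rpow_pos_of_pos ha _
  have hF := model_pos hk hp
  have d1 := ContDiffOn.diffAt isOpen_indep hf hp
  have e1 : EqOn (D (0, u) (en (model k)))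
      (fun q => 2 * unc (model k) q * D (0, u) (unc (model k)) q) (indep n) := fun q hq =>
    D_sq (ContDiffOn.diffAt isOpen_indep hf hq) _
  have e2 : D (0, u) (D (0, u) (en (model k))) p =
      2 * unc (model k) p * D (0, u) (D (0, u) (unc (model k))) p
        + 2 * D (0, u) (unc (model k)) p ^ 2 := by
    rw [D_congr isOpen_indep e1 _ hp, D_mul (d1.const_mul 2)
      (ContDiffOn.diffAt isOpen_indep (contDiffOn_D isOpen_indep hf _) hp), D_const_mul d1]
    ring
  have hcs := sub_nonneg.2 (sq_D_snd_qA_le hp u)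
  set A' := D (0, u) qA p with hA'
  set X := modelExp k (qv p / qA p) with hX
  set Q := modelQuad k (qv p / qA p) with hQd
  set R := qa p ^ (k ^ 2) with hRd
  have hdd := D_D_snd_model hk hp u
  rw [← hA', ← hX, ← hQd, ← hRd] at hdd
  have t1 : 0 ≤ 2 * (1 + k ^ 2) * X / Q ^ 2 * (inner ℝ p.1 u - qv p / qA p * A') ^ 2 := by
    positivity
  have t2 : 0 ≤ X / Q * (qa p * inner ℝ u u - (inner ℝ p.1 u) ^ 2 - A' ^ 2) :=
    mul_nonneg (by positivity) hcs
  have hdd0 : 0 ≤ D (0, u) (D (0, u) (unc (model k))) p := by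
    rw [hdd]
    exact mul_nonneg (by positivity) (add_nonneg t1 t2)
  rw [e2]
  -- Equality case: both F' and F'' vanish, so p' = 0 and A'' = 0. Then F' = R A' L forces A' = 0,
  -- hence ⟨x,u⟩ = 0, and a|u|² = 0 contradicts u ≠ 0.
  by_contra hneg
  have h1 := mul_nonneg hF.le hdd0
  have h2 := sq_nonneg (D (0, u) (unc (model k)) p)
  have h3 : D (0, u) (unc (model k)) p = 0 := by
    apply pow_eq_zero_iff (two_ne_zero) |>.1
    linarith
  have h4 : D (0, u) (D (0, u) (unc (model k))) p = 0 := by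
    apply (mul_eq_zero.1 (?_ : unc (model k) p * _ = 0)).resolve_left hF.ne'
    linarith
  rw [hdd] at h4
  have h5 := (mul_eq_zero.1 h4).resolve_left (by positivity)
  have h6 : inner ℝ p.1 u - qv p / qA p * A' = 0 := by
    have := (mul_eq_zero.1 (by linarith :
      2 * (1 + k ^ 2) * X / Q ^ 2 * (inner ℝ p.1 u - qv p / qA p * A') ^ 2 = 0)).resolve_left
      (by positivity)
    exact pow_eq_zero_iff (two_ne_zero) |>.1 this
  have h7 : qa p * inner ℝ u u - (inner ℝ p.1 u) ^ 2 - A' ^ 2 = 0 :=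
    (mul_eq_zero.1 (by linarith : X / Q * (qa p * inner ℝ u u - (inner ℝ p.1 u) ^ 2 - A' ^ 2)
      = 0)).resolve_left (by positivity)
  have h8 : inner ℝ p.1 u = qv p / qA p * A' := by linarith
  have h9 : A' = 0 := by
    rw [D_snd_model hk hp, modelDeriv, ← D_snd_qA hp, ← hA', h8, ← modelProfile_sub hk] at h3
    have h10 := (mul_eq_zero.1 h3).resolve_left hR.ne'
    have h11 : modelProfile k (qv p / qA p) * A' = 0 := by linear_combination h10
    exact (mul_eq_zero.1 h11).resolve_left (modelProfile_pos hk _).ne'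
  rw [h8, h9] at h7
  have h12 : qa p * (inner ℝ u u : ℝ) = 0 := by linarith
  exact (mul_pos ha (real_inner_self_pos.2 hu)).ne' h12

theorem isFinslerOn_model (hk : k ≠ 0) : IsFinslerOn (model (n := n) k) (nonRadial n) := by
  rw [nonRadial_eq_indep]
  have hf := contDiffOn_model (n := n) k
  have hv : ∀ (x y : E n) (c : ℝ), qv (x, c • y) = c * qv (x, y) := fun x y c => by
    simp [qv, real_inner_smul_right]
  have hg : ∀ (x y : E n) (c : ℝ), gram (x, c • y) = c ^ 2 * gram (x, y) := fun x y c => by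
    simp only [gram, qa, qb, qv, real_inner_smul_right, real_inner_smul_left]
    ring
  have hA : ∀ (x y : E n) (c : ℝ), 0 < c → qA (x, c • y) = c * qA (x, y) := fun x y c hc => by
    rw [qA, hg, Real.sqrt_mul (by positivity), Real.sqrt_sq hc.le, qA]
  refine ⟨isOpen_indep, ?_, ?_, ?_, ?_, hf, ?_⟩
  · intro x y hp hy
    have := norm_snd_pos hp
    simp [hy] at this
  · intro x y hp c hc
    refine lt_of_lt_of_eq (mul_pos (pow_pos hc 2) hp) (hg x y c).symm
  · intro x y hp
    exact model_pos hk (p := (x, y)) hp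
  · intro x y hp c hc
    have := qA_pos hp
    have h1 : c * qv (x, y) / (c * qA (x, y)) = qv (x, y) / qA (x, y) := by field_simp
    rw [model, hA x y c hc, hv, h1, model, show qa (x, c • y) = qa (x, y) from rfl]
    ring
  · intro x y hp
    have he : ContDiffOn ℝ ∞ (en (model (n := n) k)) (indep n) := hf.pow 2
    exact posDef_of_contDiffOn isOpen_indep he (p := (x, y)) hp
      fun u hu => D_D_snd_en_model_pos hk hp hu

theorem isSphericallySymmetricOn_model (k : ℝ) :
    IsSphericallySymmetricOn (modelPhi k) (model (n := n) k) (nonRadial n) := by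
  rw [nonRadial_eq_indep]
  intro x y hp
  have hb := norm_snd_pos hp
  have hA := qA_pos hp
  have h := sqrt_sq_sub_sq hp
  simp only at h hb
  have h1 : qv (x, y) / ‖y‖ / (qA (x, y) / ‖y‖) = qv (x, y) / qA (x, y) := by field_simp
  have h2 : ‖x‖ ^ 2 = qa (x, y) := norm_sq_fst (x, y)
  change _ = ‖y‖ * modelPhi k ‖x‖ (qv (x, y) / ‖y‖)
  rw [modelPhi, h, h1, h2, model]
  field_simp

theorem hasProfileOn_model (hk : k ≠ 0) :
    HasProfileOn k (fun _ => 0) id (modelPhi k) (profileDomain (nonRadial n)) := by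
  -- With h = 0 the formula φ = -sI leaves no choice for the primitive.
  refine ⟨fun r s => -(modelPhi k r s / s), fun r s hrs => ?_⟩
  obtain ⟨hs, hsr, -⟩ := hrs
  simp only at hs hsr
  have hr : 0 < r := (abs_nonneg s).trans_lt hsr
  have hpos : 0 < r ^ 2 - s ^ 2 := by
    have := sq_lt_sq' (abs_lt.1 hsr).1 (abs_lt.1 hsr).2
    linarith
  refine ⟨differentiableAt_const _, differentiableAt_id, ?_, by field_simp; ring⟩
  set w := √(r ^ 2 - s ^ 2) with hw
  have hwpos : 0 < w := Real.sqrt_pos.2 hpos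
  have hw2 : w ^ 2 = r ^ 2 - s ^ 2 := Real.sq_sqrt hpos.le
  have lw : HasDerivAt (fun s : ℝ => √(r ^ 2 - s ^ 2)) (-s / w) s := by
    have := ((hasDerivAt_pow 2 s).const_sub (r ^ 2)).sqrt hpos.ne'
    refine this.congr_deriv ?_
    rw [← hw]
    simp
    field_simp
  have lp := (hasDerivAt_id' s).div lw hwpos.ne'
  have lL := (hasDerivAt_modelProfile k (s / w)).comp s lp
  have l := (((lw.const_mul ((r ^ 2) ^ (k ^ 2))).mul lL).div (hasDerivAt_id' s) hs).neg
  refine l.congr_deriv ?_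
  have hQ := modelQuad_pos k (s / w)
  have e1 : k ^ 2 * s ^ 2 - 2 * k * s * w + r ^ 2 = w ^ 2 * modelQuad k (s / w) := by
    rw [show r ^ 2 = w ^ 2 + s ^ 2 by linarith, modelQuad]
    field_simp
    ring
  have e2 : r ^ (2 * (k ^ 2 + 1)) = (r ^ 2) ^ (k ^ 2) * (w ^ 2 + s ^ 2) := by
    rw [Real.rpow_mul hr.le, Real.rpow_two, Real.rpow_add_one (by positivity),
      show w ^ 2 + s ^ 2 = r ^ 2 by linarith]
  have e3 : Real.exp (2 * k * Real.arctan (k - (1 + k ^ 2) * s / w)) = modelExp k (s / w) := by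
    rw [modelExp, mul_div_assoc]
  have e4 : modelExp k (s / w) =
      modelQuad k (s / w) * (modelProfile k (s / w) - s / w * modelSlope k (s / w)) := by
    rw [modelProfile_sub hk]; field_simp
  simp only [id, phiBar, Pi.mul_apply, Pi.div_apply, Function.comp]
  rw [← hw, e1, e2, ← hw2, e3, e4]
  field_simp
  ring

end Model

theorem nonRadial_nonempty (hn : 2 ≤ n) : (nonRadial n).Nonempty := by
  rw [nonRadial_eq_indep]
  obtain ⟨e, he, -⟩ := exists_orthogonal (n := n) ∅ (by simp; omega)
  obtain ⟨f, hf, hef⟩ := exists_orthogonal {e} (by simp; omega)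
  have hef' : (inner ℝ e f : ℝ) = 0 := hef _ (by simp)
  refine ⟨(e, f), ?_⟩
  change 0 < (inner ℝ e e : ℝ) * inner ℝ f f - (inner ℝ e f : ℝ) ^ 2
  have := real_inner_self_pos.2 he
  have := real_inner_self_pos.2 hf
  rw [hef']
  simp only [ne_eq, OfNat.ofNat_ne_zero, not_false_eq_true, zero_pow, sub_zero]
  positivity

end SphFinsler

end

theorem theorem1 :
    (∀ (n : ℕ) (k : ℝ) (h η : ℝ → ℝ) (φ : ℝ → ℝ → ℝ)
        (F : SphFinsler.E n → SphFinsler.E n → ℝ) (U : Set (SphFinsler.E n × SphFinsler.E n)),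
      SphFinsler.IsFinslerOn F U →
      SphFinsler.IsSphericallySymmetricOn φ F U →
      SphFinsler.HasProfileOn k h η φ (SphFinsler.profileDomain U) →
        SphFinsler.HasScalarFlagCurvature F U ∧
        (k = 0 → SphFinsler.IsProjectivelyFlatOn F U) ∧
        (3 ≤ n → k ≠ 0 → U.Nonempty → ¬ SphFinsler.IsDouglasOn F U)) ∧
    (∀ (n : ℕ) (k : ℝ), 3 ≤ n → k ≠ 0 →
      ∃ (h η : ℝ → ℝ) (φ : ℝ → ℝ → ℝ) (F : SphFinsler.E n → SphFinsler.E n → ℝ),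
        SphFinsler.IsFinslerOn F (SphFinsler.nonRadial n) ∧
        SphFinsler.IsSphericallySymmetricOn φ F (SphFinsler.nonRadial n) ∧
        SphFinsler.HasProfileOn k h η φ (SphFinsler.profileDomain (SphFinsler.nonRadial n)) ∧
        SphFinsler.HasScalarFlagCurvature F (SphFinsler.nonRadial n) ∧
        ¬ SphFinsler.IsDouglasOn F (SphFinsler.nonRadial n)) := by
  refine ⟨fun n k h η φ F U hF hS hP => ⟨?_, ?_, ?_⟩, fun n k hn hk => ?_⟩
  · exact SphFinsler.hasScalarFlagCurvature_of_profile hF hS hP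
  · rintro rfl
    exact SphFinsler.isProjectivelyFlatOn_of_profile hF hS hP
  · exact fun hn hk hU => SphFinsler.not_isDouglasOn_of_profile hF hS hP hn hk hU
  · have hF := SphFinsler.isFinslerOn_model (n := n) hk
    have hS := SphFinsler.isSphericallySymmetricOn_model (n := n) k
    have hP := SphFinsler.hasProfileOn_model (n := n) hk
    exact ⟨fun _ => 0, id, SphFinsler.modelPhi k, SphFinsler.model k, hF, hS, hP,
      SphFinsler.hasScalarFlagCurvature_of_profile hF hS hP,
      SphFinsler.not_isDouglasOn_of_profile hF hS hP hn hk
        (SphFinsler.nonRadial_nonempty (by omega))⟩
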